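/- Let $n,m\ge 1$ be integers and $q_0,q_1\in(-1,1)$. For $-1<q<1$ put $u_q(\theta)=\frac{1-q^2}{1-2q\cos\theta+q^2}$ and $v_q(\vartheta)=\int_0^\vartheta u_q(\theta)\,d\theta$. Let $\mathbb{A}^{(n)}=\{\xi\in\mathbb{R}^n\mid \pi>\xi_1>\cdots>\xi_n>0\}$, $\Lambda^{(m,n)}=\{\mu\in\mathbb{Z}^n\mid m\ge\mu_1\ge\cdots\ge\mu_n\ge 0\}$, and $$\rho(\xi)=2^{n(n+1)}\prod_{j}(1-\cos^2\xi_j)\prod_{j<k}(\cos\xi_j-\cos\xi_k)^2 .$$ Let $\mathbb{P}^{(m,n)}$ be the complex span of the hyperoctahedral symmetric monomials $M_\mu(\xi)$, $\mu\in\Lambda^{(m,n)}$, where $M_\mu$ is the sum of the distinct exponentials among $e^{i(\epsilon_1\xi_{\sigma_1}\mu_1+\cdots+\epsilon_n\xi_{\sigma_n}\mu_n)}$ $(\sigma\in S_n,\ \epsilon\in\{1,-1\}^n)$. Let $$C(\xi;q,q_0)=\prod_{j}\frac{1-q_0e^{-i\xi_j}}{1-e^{-2i\xi_j}}\prod_{j<k}\frac{1-qe^{-i(\xi_j-\xi_k)}}{1-e^{-i(\xi_j-\xi_k)}}\cdot\frac{1-qe^{-i(\xi_j+\xi_k)}}{1-e^{-i(\xi_j+\xi_k)}},$$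 $$P_\mu(\xi;q,q_0)=\sum_{\sigma\in S_n,\,\epsilon\in\{1,-1\}^n}C(\epsilon_1\xi_{\sigma_1},\ldots,\epsilon_n\xi_{\sigma_n};q,q_0)\,e^{i\epsilon_1\xi_{\sigma_1}\mu_1+\cdots+i\epsilon_n\xi_{\sigma_n}\mu_n},$$ $$\delta_\mu(q)=\prod_{j<k,\ \mu_j=\mu_k}\frac{1-q^{k-j}}{1-q^{1+k-j}},$$ $$O(\xi;q,q_0)=\prod_{j<k}(1-2q\cos(\xi_j-\xi_k)+q^2)(1-2q\cos(\xi_j+\xi_k)+q^2)\prod_j(1-2q_0\cos\xi_j+q_0^2).$$ For $\lambda\in\Lambda^{(m,n)}$ let $\xi^{(m,n)}_\lambda\in\mathbb{R}^n$ be the global minimum of $$V^{(m,n)}_\lambda(\xi)=\sum_{j<k}\Bigl(\int_0^{\xi_j+\xi_k}v_q(\vartheta)\,d\vartheta+\int_0^{\xi_j-\xi_k}v_q(\vartheta)\,d\vartheta\Bigr)+\sum_{j}\Bigl((m+1)\xi_j^2-2\pi(n+1-j+\lambda_j)\xi_j+\int_0^{\xi_j}(v_{q_0}(\vartheta)+v_{q_1}(\vartheta))\,d\vartheta\Bigr),$$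 and define the Christoffel weights $$\Delta^{(m,n)}_\lambda=\bigl|C(\xi^{(m,n)}_\lambda;q,q_0)\bigr|^2\Bigl(\sum_{\mu\in\Lambda^{(m,n)}}\bigl|P_\mu(\xi^{(m,n)}_\lambda;q,q_0)\bigr|^2\delta_\mu(q)\Bigr)^{-1}.$$ Let $q=0$. Then the following holds. 1. For every $\lambda\in\Lambda^{(m,n)}$ the function $V^{(m,n)}_\lambda$ has exactly one global minimum $\xi^{(m,n)}_\lambda$, and it lies in $\mathbb{A}^{(n)}$. 2. For every $f\in\mathbb{P}^{(2m,n)}$, the function $R(\xi)=f(\xi)/O(\xi;0,q_0)$ equals $f(\xi)/\prod_{j}(1-2q_0\cos\xi_j+q_0^2)$, the product $R\rho$ is integrable on $\mathbb{A}^{(n)}$, and $$\frac{1}{(2\pi)^n}\int_{\mathbb{A}^{(n)}}R(\xi)\rho(\xi)\,d\xi=\sum_{\lambda\in\Lambda^{(m,n)}}R(\xi^{(m,n)}_\lambda)\,\rho(\xi^{(m,n)}_\lambda)\,\Delta^{(m,n)}_\lambda .$$ 3. For $0\le l<m+n$ write $\xi^{(m+n)}_l:=\xi^{(m+n-1,1)}_{l}$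 and $\Delta^{(m+n)}_l:=\Delta^{(m+n-1,1)}_{l}$ for the node and Christoffel weight with one variable at level $m+n-1$. For every $\lambda\in\Lambda^{(m,n)}$, $$\xi^{(m,n)}_\lambda=\bigl(\xi^{(m+n)}_{\lambda_1+n-1},\xi^{(m+n)}_{\lambda_2+n-2},\ldots,\xi^{(m+n)}_{\lambda_n}\bigr),\qquad \Delta^{(m,n)}_\lambda=\prod_{1\le j\le n}\Delta^{(m+n)}_{\lambda_j+n-j}.$$ 4. For $0\le l<m+n$, $\xi^{(m+n)}_l$ is the unique real root of $$2(m+n)\xi+v_{q_0}(\xi)+v_{q_1}(\xi)=2\pi(l+1),$$ and $$\Delta^{(m+n)}_l=\bigl(2(m+n)+u_{q_0}(\xi^{(m+n)}_l)+u_{q_1}(\xi^{(m+n)}_l)\bigr)^{-1}.$$ -/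

import Mathlib

open MeasureTheory

namespace HallLittlewoodB

noncomputable section

/-- `u_q(θ) = (1 - q²) / (1 - 2 q cos θ + q²)`. -/
def u (q θ : ℝ) : ℝ := (1 - q ^ 2) / (1 - 2 * q * Real.cos θ + q ^ 2)

/-- `v_q(ϑ) = ∫₀^ϑ u_q(θ) dθ`. -/
def v (q ϑ : ℝ) : ℝ := ∫ θ in (0 : ℝ)..ϑ, u q θ

/-- The fundamental domain `π > ξ₁ > ξ₂ > ⋯ > ξₙ > 0`. -/
def alcove (n : ℕ) : Set (Fin n → ℝ) :=
  {ξ | (∀ j, 0 < ξ j ∧ ξ j < Real.pi) ∧ StrictAnti ξ}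

/-- The density of the circular quaternion ensemble on the fundamental domain. -/
def rho {n : ℕ} (ξ : Fin n → ℝ) : ℝ :=
  2 ^ (n * (n + 1)) * (∏ j, (1 - Real.cos (ξ j) ^ 2)) *
    ∏ j, ∏ k ∈ Finset.Ioi j, (Real.cos (ξ j) - Real.cos (ξ k)) ^ 2

open Classical in
/-- The finite set of integral vectors `m ≥ μ₁ ≥ ⋯ ≥ μₙ ≥ 0`. -/
def weights (m n : ℕ) : Finset (Fin n → ℕ) :=
  {μ ∈ Fintype.piFinset (fun _ : Fin n => Finset.range (m + 1)) | Antitone μ}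

/-- The function `C(ξ; q, q₀)`. -/
def cFun {n : ℕ} (q q0 : ℝ) (ξ : Fin n → ℝ) : ℂ :=
  (∏ j, (1 - (q0 : ℂ) * Complex.exp (-Complex.I * (ξ j : ℂ))) /
      (1 - Complex.exp (-2 * Complex.I * (ξ j : ℂ)))) *
    ∏ j, ∏ k ∈ Finset.Ioi j,
      ((1 - (q : ℂ) * Complex.exp (-Complex.I * ((ξ j : ℂ) - (ξ k : ℂ)))) /
          (1 - Complex.exp (-Complex.I * ((ξ j : ℂ) - (ξ k : ℂ))))) *
      ((1 - (q : ℂ) * Complex.exp (-Complex.I * ((ξ j : ℂ) + (ξ k : ℂ)))) /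
          (1 - Complex.exp (-Complex.I * ((ξ j : ℂ) + (ξ k : ℂ)))))

/-- The action of a signed permutation: `(ε₁ ξ_{σ₁}, …, εₙ ξ_{σₙ})`. -/
def signedPerm {n : ℕ} (σ : Equiv.Perm (Fin n)) (ε : Fin n → ℤˣ) (ξ : Fin n → ℝ) :
    Fin n → ℝ :=
  fun j => ((ε j : ℤ) : ℝ) * ξ (σ j)

/-- The plane wave `exp (i ξ₁ μ₁ + ⋯ + i ξₙ μₙ)`. -/
def planeWave {n : ℕ} (μ : Fin n → ℕ) (ξ : Fin n → ℝ) : ℂ :=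
  Complex.exp (∑ j, Complex.I * (ξ j : ℂ) * (μ j : ℂ))

/-- The hyperoctahedral Hall-Littlewood polynomial `P_μ(ξ; q, q₀)`, through its defining formula,
which makes sense off the walls (in particular on the fundamental domain). -/
def hallLittlewood {n : ℕ} (q q0 : ℝ) (μ : Fin n → ℕ) (ξ : Fin n → ℝ) : ℂ :=
  ∑ σ : Equiv.Perm (Fin n), ∑ ε : Fin n → ℤˣ,
    cFun q q0 (signedPerm σ ε ξ) * planeWave μ (signedPerm σ ε ξ)

/-- `δ_μ(q)`, the product of `(1 - q^{k-j}) / (1 - q^{1+k-j})` over `j < k` with `μ_j = μ_k`. -/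
def delta {n : ℕ} (q : ℝ) (μ : Fin n → ℕ) : ℝ :=
  ∏ j, ∏ k ∈ Finset.Ioi j,
    if μ j = μ k then
      (1 - q ^ ((k : ℕ) - (j : ℕ))) / (1 - q ^ (1 + (k : ℕ) - (j : ℕ)))
    else 1

/-- The order of the stabilizer of `μ` in the hyperoctahedral group. -/
def stabOrder {n : ℕ} (μ : Fin n → ℕ) : ℂ :=
  2 ^ (Finset.univ.filter fun j => μ j = 0).card *
    ∏ j, ∏ k ∈ Finset.Ioi j,
      if μ j = μ k then
        (1 + ((k : ℕ) : ℂ) - ((j : ℕ) : ℂ)) / (((k : ℕ) : ℂ) - ((j : ℕ) : ℂ))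
      else 1

/-- The symmetric monomial `M_μ(ξ)`. -/
def symMonomial {n : ℕ} (μ : Fin n → ℕ) (ξ : Fin n → ℝ) : ℂ :=
  (1 / stabOrder μ) *
    ∑ σ : Equiv.Perm (Fin n), ∑ ε : Fin n → ℤˣ, planeWave μ (signedPerm σ ε ξ)

/-- The space spanned by the symmetric monomials `M_μ` with `m ≥ μ₁ ≥ ⋯ ≥ μₙ ≥ 0`. -/
def polySpace (m n : ℕ) : Submodule ℂ ((Fin n → ℝ) → ℂ) :=
  Submodule.span ℂ (symMonomial '' (weights m n : Set (Fin n → ℕ)))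

/-- The Morse function whose global minimum is the cubature node with label `lam` at level `m`.
The index `j : Fin n` is zero-based, so that `ϱ_j = n + 1 - j` reads `n - j`. -/
def morse {n : ℕ} (m : ℕ) (q q0 q1 : ℝ) (lam : Fin n → ℕ) (ξ : Fin n → ℝ) : ℝ :=
  (∑ j, ∑ k ∈ Finset.Ioi j,
      ((∫ ϑ in (0 : ℝ)..(ξ j + ξ k), v q ϑ) + ∫ ϑ in (0 : ℝ)..(ξ j - ξ k), v q ϑ)) +
    ∑ j, (((m : ℝ) + 1) * ξ j ^ 2
      - 2 * Real.pi * (((n : ℝ) - ((j : ℕ) : ℝ)) + (lam j : ℝ)) * ξ j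
      + ∫ ϑ in (0 : ℝ)..(ξ j), (v q0 ϑ + v q1 ϑ))

/-- `ξ` is a global minimum of the Morse function. -/
def IsNode {n : ℕ} (m : ℕ) (q q0 q1 : ℝ) (lam : Fin n → ℕ) (ξ : Fin n → ℝ) : Prop :=
  ∀ η : Fin n → ℝ, morse m q q0 q1 lam ξ ≤ morse m q q0 q1 lam η

/-- The cubature node `ξ^{(m,n)}_λ`: the global minimum of the Morse function. -/
def node {n : ℕ} (m : ℕ) (q q0 q1 : ℝ) (lam : Fin n → ℕ) : Fin n → ℝ :=
  Classical.epsilon (IsNode m q q0 q1 lam)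

/-- The weight `(∑_μ |P_μ(ξ_λ; q, q₀)|² δ_μ(q))⁻¹`. -/
def christoffelHat {n : ℕ} (m : ℕ) (q q0 q1 : ℝ) (lam : Fin n → ℕ) : ℝ :=
  (∑ μ ∈ weights m n, ‖hallLittlewood q q0 μ (node m q q0 q1 lam)‖ ^ 2 * delta q μ)⁻¹

/-- The Christoffel weight `|C(ξ_λ; q, q₀)|² (∑_μ |P_μ(ξ_λ; q, q₀)|² δ_μ(q))⁻¹`. -/
def christoffel {n : ℕ} (m : ℕ) (q q0 q1 : ℝ) (lam : Fin n → ℕ) : ℝ :=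
  ‖cFun q q0 (node m q q0 q1 lam)‖ ^ 2 * christoffelHat m q q0 q1 lam

/-- The denominator `O(ξ; q, q₀)`. -/
def denomO {n : ℕ} (q q0 : ℝ) (ξ : Fin n → ℝ) : ℝ :=
  (∏ j, ∏ k ∈ Finset.Ioi j,
      (1 - 2 * q * Real.cos (ξ j - ξ k) + q ^ 2) * (1 - 2 * q * Real.cos (ξ j + ξ k) + q ^ 2)) *
    ∏ j, (1 - 2 * q0 * Real.cos (ξ j) + q0 ^ 2)

/-- The rational symmetric function `R(ξ) = f(ξ) / O(ξ; q, q₀)`. -/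
def ratFun {n : ℕ} (q q0 : ℝ) (f : (Fin n → ℝ) → ℂ) (ξ : Fin n → ℝ) : ℂ :=
  f ξ / (denomO q q0 ξ : ℂ)

/-- The one-variable node `ξ^{(N)}_l`, that is, the node at level `N - 1` for `n = 1`. -/
def node1 (N : ℕ) (q0 q1 : ℝ) (l : ℕ) : ℝ :=
  node (n := 1) (N - 1) 0 q0 q1 (fun _ => l) 0

/-- The one-variable Christoffel weight, at level `N - 1` for `n = 1`. -/
def christoffel1 (N : ℕ) (q0 q1 : ℝ) (l : ℕ) : ℝ :=
  christoffel (n := 1) (N - 1) 0 q0 q1 (fun _ => l)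

end

end HallLittlewoodB

namespace HallLittlewoodB

noncomputable section

variable {q q0 q1 : ℝ} {n : ℕ}

/-! At `q = 0` the model becomes free. Since `v 0` is the identity, the two integrals attached to a
pair add up to ξ_j² + ξ_k², so the Morse function is a sum of one-variable functions with N = m + n
and strictly decreasing labels l_j = λ_j + n - 1 - j, j counted from zero (`morse_zero`). Each
summand has a strictly increasing derivative, so its only minimum is the root of the node equation
(`isNode_iff`).

In one variable, the functions b_l(x) = 2(sin (l+1)x - q₀ sin lx) are orthogonal on (0, π) for dx/(1
- 2q₀ cos x + q₀²), with squared norm 2π (`integral_bernsteinSzego_mul`). The node equation forces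
b_N = q₁ b_{N-1}, so the Christoffel-Darboux kernel vanishes at two distinct roots. The N × N matrix
of values b_i(root_j) thus has orthogonal columns, and after weighting orthogonal rows
(`sum_root_bernsteinSzego_mul`). A quadrature rule follows, exact on products of two elements of the
span of b_0, …, b_{N-1}, that is, on 4 sin² x times polynomials of degree at most 2N - 2 in cos x
(`quadrature_one`). The node equation also evaluates the kernel on the diagonal, which gives the
explicit weights (`kernelDiag_root`).

In n variables, antisymmetrization writes P_μ as det b_{l_j}(ξ_k) over the Weyl denominator
(`hallLittlewood_zero`). Cauchy-Binet then computes the sum of |P_μ|² at a node, ρ cancels, and the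
Christoffel weight factors (`christoffel_eq`). For the cubature rule, Rρ is f times a squared
Vandermonde product times one-variable densities. The polynomial part has degree at most 2m + 2(n-1)
= 2N - 2 in each cosine, so the product rule on the cube is exact. Integrand and summand are
symmetric and vanish when two coordinates coincide, so both sides are n! times their restrictions to
decreasing points and labels (`cubature`). -/

/-! ### The angle function -/

/-- The quadratic trigonometric denominator `1 - 2 q cos x + q²`. -/
def quadDen (q x : ℝ) : ℝ := 1 - 2 * q * Real.cos x + q ^ 2

lemma quadDen_pos (hq : q ∈ Set.Ioo (-1 : ℝ) 1) (x : ℝ) : 0 < quadDen q x := by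
  have h1 := Real.cos_le_one x
  have h2 := Real.neg_one_le_cos x
  have h3 := hq.1
  have h4 := hq.2
  unfold quadDen
  nlinarith [sq_nonneg (q - Real.cos x), mul_nonneg (sub_nonneg.2 h1) (sub_nonneg.2 h2),
    mul_pos (sub_pos.2 h3) (sub_pos.2 h4), sq_nonneg (Real.cos x * q - 1),
    mul_nonneg (sub_nonneg.2 h1) (sub_nonneg.2 h3.le),
    mul_nonneg (by linarith : 0 ≤ Real.cos x + 1) (sub_nonneg.2 h4.le)]

lemma continuous_quadDen (q : ℝ) : Continuous (quadDen q) := by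
  unfold quadDen; fun_prop

lemma one_sub_mul_cos_pos (hq : q ∈ Set.Ioo (-1 : ℝ) 1) (x : ℝ) :
    0 < 1 - q * Real.cos x := by
  have h : |q * Real.cos x| < 1 := by
    rw [abs_mul]
    have h1 : |q| < 1 := abs_lt.2 hq
    nlinarith [Real.abs_cos_le_one x, abs_nonneg q, abs_nonneg (Real.cos x)]
  linarith [(abs_lt.1 h).2]

lemma u_eq (q x : ℝ) : u q x = (1 - q ^ 2) / quadDen q x := rfl

lemma u_pos (hq : q ∈ Set.Ioo (-1 : ℝ) 1) (x : ℝ) : 0 < u q x := by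
  have h3 := hq.1
  have h4 := hq.2
  exact div_pos (by nlinarith) (quadDen_pos hq x)

lemma continuous_u (hq : q ∈ Set.Ioo (-1 : ℝ) 1) : Continuous (u q) :=
  continuous_const.div (continuous_quadDen q) fun x => (quadDen_pos hq x).ne'

/-- The argument of `1 - q e^{-ix}`. -/
def phase (q x : ℝ) : ℝ := Real.arctan (q * Real.sin x / (1 - q * Real.cos x))

/-- The Poisson kernel is the derivative of x + 2 arg(1 - q e^{-ix}). The arctangent is a global
branch of this argument because the real part 1 - q cos x stays positive. -/
lemma hasDerivAt_phase (hq : q ∈ Set.Ioo (-1 : ℝ) 1) (x : ℝ) :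
    HasDerivAt (fun y => y + 2 * phase q y) (u q x) x := by
  have hc := (one_sub_mul_cos_pos hq x).ne'
  have hw := (quadDen_pos hq x).ne'
  have h1 : HasDerivAt (fun y => q * Real.sin y / (1 - q * Real.cos y))
      ((q * Real.cos x * (1 - q * Real.cos x) - q * Real.sin x * (-(q * -Real.sin x))) /
        (1 - q * Real.cos x) ^ 2) x :=
    ((Real.hasDerivAt_sin x).const_mul q).div
      (((Real.hasDerivAt_cos x).const_mul q).const_sub 1) hc
  have h2 := (hasDerivAt_id x).add (h1.arctan.const_mul 2)
  refine h2.congr_deriv ?_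
  have h3 : 1 + (q * Real.sin x / (1 - q * Real.cos x)) ^ 2 =
      quadDen q x / (1 - q * Real.cos x) ^ 2 := by
    unfold quadDen
    field_simp
    linear_combination q ^ 2 * Real.sin_sq_add_cos_sq x
  rw [h3, u_eq]
  field_simp
  unfold quadDen
  linear_combination -(2 * q ^ 2) * Real.sin_sq_add_cos_sq x

lemma v_eq (hq : q ∈ Set.Ioo (-1 : ℝ) 1) (x : ℝ) : v q x = x + 2 * phase q x := by
  have h := intervalIntegral.integral_eq_sub_of_hasDerivAt (a := 0) (b := x)
    (fun y _ => hasDerivAt_phase hq y) ((continuous_u hq).intervalIntegrable _ _)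
  rw [v, h]
  simp [phase]

lemma hasDerivAt_v (hq : q ∈ Set.Ioo (-1 : ℝ) 1) (x : ℝ) :
    HasDerivAt (v q) (u q x) x := by
  rw [funext (v_eq hq)]
  exact hasDerivAt_phase hq x

lemma continuous_v (hq : q ∈ Set.Ioo (-1 : ℝ) 1) : Continuous (v q) :=
  continuous_iff_continuousAt.2 fun x => (hasDerivAt_v hq x).continuousAt

lemma v_zero_right (q : ℝ) : v q 0 = 0 := by simp [v]

lemma v_pi (hq : q ∈ Set.Ioo (-1 : ℝ) 1) : v q Real.pi = Real.pi := by
  simp [v_eq hq, phase]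

lemma v_zero_left (x : ℝ) : v 0 x = x := by simp [v, u]

/-! ### One-variable nodes -/

/-- The increasing function `2 N x + v_{q₀}(x) + v_{q₁}(x)`. -/
def nodeFun (N : ℕ) (q0 q1 x : ℝ) : ℝ := 2 * (N : ℝ) * x + v q0 x + v q1 x

lemma hasDerivAt_nodeFun (N : ℕ) (hq0 : q0 ∈ Set.Ioo (-1 : ℝ) 1) (hq1 : q1 ∈ Set.Ioo (-1 : ℝ) 1)
    (x : ℝ) : HasDerivAt (nodeFun N q0 q1) (2 * (N : ℝ) + u q0 x + u q1 x) x := by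
  refine ((((hasDerivAt_id x).const_mul (2 * (N : ℝ))).add (hasDerivAt_v hq0 x)).add
    (hasDerivAt_v hq1 x)).congr_deriv ?_
  simp

lemma nodeFun_deriv_pos (N : ℕ) (hq0 : q0 ∈ Set.Ioo (-1 : ℝ) 1) (hq1 : q1 ∈ Set.Ioo (-1 : ℝ) 1)
    (x : ℝ) : 0 < 2 * (N : ℝ) + u q0 x + u q1 x := by
  have := u_pos hq0 x
  have := u_pos hq1 x
  positivity

lemma strictMono_nodeFun (N : ℕ) (hq0 : q0 ∈ Set.Ioo (-1 : ℝ) 1)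
    (hq1 : q1 ∈ Set.Ioo (-1 : ℝ) 1) : StrictMono (nodeFun N q0 q1) :=
  strictMono_of_deriv_pos fun x => by
    rw [(hasDerivAt_nodeFun N hq0 hq1 x).deriv]
    exact nodeFun_deriv_pos N hq0 hq1 x

lemma continuous_nodeFun (N : ℕ) (hq0 : q0 ∈ Set.Ioo (-1 : ℝ) 1)
    (hq1 : q1 ∈ Set.Ioo (-1 : ℝ) 1) : Continuous (nodeFun N q0 q1) :=
  continuous_iff_continuousAt.2 fun x => (hasDerivAt_nodeFun N hq0 hq1 x).continuousAt

lemma exists_nodeFun_eq {N l : ℕ} (hq0 : q0 ∈ Set.Ioo (-1 : ℝ) 1)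
    (hq1 : q1 ∈ Set.Ioo (-1 : ℝ) 1) (hl : l < N) :
    ∃ x, nodeFun N q0 q1 x = 2 * Real.pi * ((l : ℝ) + 1) := by
  have hpi := Real.pi_pos
  have hl' : (l : ℝ) + 1 ≤ N := by exact_mod_cast hl
  -- The endpoint values are 0 and 2π(N + 1), and l < N puts 2π(l + 1) strictly between them.
  obtain ⟨x, -, hx⟩ := intermediate_value_Icc hpi.le (continuous_nodeFun N hq0 hq1).continuousOn
    (show 2 * Real.pi * ((l : ℝ) + 1) ∈ _ from ⟨by
      simp only [nodeFun, v_zero_right]; norm_num; positivity, by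
      simp only [nodeFun, v_pi hq0, v_pi hq1]; nlinarith⟩)
  exact ⟨x, hx⟩

/-- The root of `2 N x + v_{q₀}(x) + v_{q₁}(x) = 2 π (l + 1)`. -/
def root (N : ℕ) (q0 q1 : ℝ) (l : ℕ) : ℝ :=
  Classical.epsilon fun x => nodeFun N q0 q1 x = 2 * Real.pi * ((l : ℝ) + 1)

lemma nodeFun_root {N l : ℕ} (hq0 : q0 ∈ Set.Ioo (-1 : ℝ) 1) (hq1 : q1 ∈ Set.Ioo (-1 : ℝ) 1)
    (hl : l < N) : nodeFun N q0 q1 (root N q0 q1 l) = 2 * Real.pi * ((l : ℝ) + 1) :=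
  Classical.epsilon_spec (exists_nodeFun_eq hq0 hq1 hl)

lemma nodeFun_eq_iff {N l : ℕ} (hq0 : q0 ∈ Set.Ioo (-1 : ℝ) 1) (hq1 : q1 ∈ Set.Ioo (-1 : ℝ) 1)
    (hl : l < N) (x : ℝ) :
    nodeFun N q0 q1 x = 2 * Real.pi * ((l : ℝ) + 1) ↔ x = root N q0 q1 l := by
  rw [← nodeFun_root hq0 hq1 hl]
  exact (strictMono_nodeFun N hq0 hq1).injective.eq_iff

lemma root_mem_Ioo {N l : ℕ} (hq0 : q0 ∈ Set.Ioo (-1 : ℝ) 1) (hq1 : q1 ∈ Set.Ioo (-1 : ℝ) 1)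
    (hl : l < N) : root N q0 q1 l ∈ Set.Ioo 0 Real.pi := by
  have hpi := Real.pi_pos
  have hl' : (l : ℝ) + 1 ≤ N := by exact_mod_cast hl
  have h := strictMono_nodeFun N hq0 hq1
  constructor
  · rw [← h.lt_iff_lt, nodeFun_root hq0 hq1 hl]
    simp only [nodeFun, v_zero_right]; norm_num; positivity
  · rw [← h.lt_iff_lt, nodeFun_root hq0 hq1 hl]
    simp only [nodeFun, v_pi hq0, v_pi hq1]; nlinarith

lemma root_lt_root {N k l : ℕ} (hq0 : q0 ∈ Set.Ioo (-1 : ℝ) 1) (hq1 : q1 ∈ Set.Ioo (-1 : ℝ) 1)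
    (hl : l < N) (hkl : k < l) : root N q0 q1 k < root N q0 q1 l := by
  rw [← (strictMono_nodeFun N hq0 hq1).lt_iff_lt, nodeFun_root hq0 hq1 hl,
    nodeFun_root hq0 hq1 (hkl.trans hl)]
  have : (k : ℝ) < l := by exact_mod_cast hkl
  nlinarith [Real.pi_pos]

lemma root_injOn {N : ℕ} (hq0 : q0 ∈ Set.Ioo (-1 : ℝ) 1) (hq1 : q1 ∈ Set.Ioo (-1 : ℝ) 1) :
    Set.InjOn (root N q0 q1) (Set.Iio N) :=
  StrictMonoOn.injOn fun _ _ _ hl hkl => root_lt_root hq0 hq1 hl hkl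

/-! ### The Morse function -/

/-- The one-variable Morse function at `q = 0`. -/
def morse1 (N : ℕ) (q0 q1 : ℝ) (l : ℕ) (x : ℝ) : ℝ :=
  (N : ℝ) * x ^ 2 - 2 * Real.pi * ((l : ℝ) + 1) * x + ∫ t in (0 : ℝ)..x, (v q0 t + v q1 t)

lemma hasDerivAt_morse1 (N l : ℕ) (hq0 : q0 ∈ Set.Ioo (-1 : ℝ) 1)
    (hq1 : q1 ∈ Set.Ioo (-1 : ℝ) 1) (x : ℝ) :
    HasDerivAt (morse1 N q0 q1 l) (nodeFun N q0 q1 x - 2 * Real.pi * ((l : ℝ) + 1)) x := by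
  have hc : Continuous fun t => v q0 t + v q1 t := (continuous_v hq0).add (continuous_v hq1)
  refine ((((hasDerivAt_pow 2 x).const_mul (N : ℝ)).sub
    ((hasDerivAt_id x).const_mul (2 * Real.pi * ((l : ℝ) + 1)))).add
    (hc.integral_hasStrictDerivAt 0 x).hasDerivAt).congr_deriv ?_
  simp only [nodeFun]; push_cast; ring

/-- The derivative is the strictly increasing node function minus its target value, so it is
negative before the root and positive after it. -/
lemma morse1_root_lt {N l : ℕ} (hq0 : q0 ∈ Set.Ioo (-1 : ℝ) 1) (hq1 : q1 ∈ Set.Ioo (-1 : ℝ) 1)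
    (hl : l < N) {x : ℝ} (hx : x ≠ root N q0 q1 l) :
    morse1 N q0 q1 l (root N q0 q1 l) < morse1 N q0 q1 l x := by
  have hd := hasDerivAt_morse1 (q0 := q0) (q1 := q1) N l hq0 hq1
  have hc : Continuous (morse1 N q0 q1 l) :=
    continuous_iff_continuousAt.2 fun x => (hd x).continuousAt
  have hr := nodeFun_root hq0 hq1 hl
  have hm := strictMono_nodeFun N hq0 hq1
  rcases lt_or_gt_of_ne hx with h | h
  · refine strictAntiOn_of_deriv_neg (convex_Iic (root N q0 q1 l)) hc.continuousOn ?_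
      h.le (Set.mem_Iic.2 le_rfl) h
    intro y hy
    rw [interior_Iic] at hy
    rw [(hd y).deriv, ← hr]
    exact sub_neg.2 (hm hy)
  · refine strictMonoOn_of_deriv_pos (convex_Ici (root N q0 q1 l)) hc.continuousOn ?_
      (Set.mem_Ici.2 le_rfl) h.le h
    intro y hy
    rw [interior_Ici] at hy
    rw [(hd y).deriv, ← hr]
    exact sub_pos.2 (hm hy)

/-- Every index lies in n - 1 pairs: n - 1 - j times as the smaller one and j times as the larger
one. This serves both the Morse function and the degree of the Vandermonde product. -/
lemma sum_sum_Ioi_add {n : ℕ} (h : Fin n → ℝ) :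
    ∑ j, ∑ k ∈ Finset.Ioi j, (h j + h k) = ((n : ℝ) - 1) * ∑ j, h j := by
  have h1 : ∑ j, ∑ k ∈ Finset.Ioi j, h k = ∑ k, ∑ j ∈ Finset.Iio k, h k :=
    Finset.sum_comm' (by simp)
  simp only [Finset.sum_add_distrib]
  rw [h1, ← Finset.sum_add_distrib, Finset.mul_sum]
  refine Finset.sum_congr rfl fun j _ => ?_
  have hj : (j : ℕ) + 1 ≤ n := j.2
  simp only [Finset.sum_const, nsmul_eq_mul, Fin.card_Ioi, Fin.card_Iio]
  rw [Nat.sub_sub, Nat.cast_sub (by omega)]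
  push_cast
  ring

/-- The strictly decreasing label attached to the weight `μ`. -/
def shifted {n : ℕ} (μ : Fin n → ℕ) (j : Fin n) : ℕ := μ j + (n - 1 - (j : ℕ))

lemma shifted_add_one {n : ℕ} (μ : Fin n → ℕ) (j : Fin n) :
    ((shifted μ j : ℕ) : ℝ) + 1 = ((n : ℝ) - ((j : ℕ) : ℝ)) + (μ j : ℝ) := by
  have hj := j.2
  rw [shifted, Nat.sub_sub]
  push_cast [Nat.cast_sub (show 1 + (j : ℕ) ≤ n by omega)]
  ring

/-- The pair terms contribute (n - 1) ∑ ξ_j², which raises the coefficient m + 1 to m + n and leaves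
no interaction. -/
lemma morse_zero {n : ℕ} (m : ℕ) (q0 q1 : ℝ) (lam : Fin n → ℕ) (ξ : Fin n → ℝ) :
    morse m 0 q0 q1 lam ξ = ∑ j, morse1 (m + n) q0 q1 (shifted lam j) (ξ j) := by
  have h1 : ∀ a : ℝ, ∫ t in (0 : ℝ)..a, v 0 t = a ^ 2 / 2 := by
    intro a; simp [v_zero_left]
  have h2 : ∀ j k : Fin n, (∫ ϑ in (0 : ℝ)..(ξ j + ξ k), v 0 ϑ) +
      ∫ ϑ in (0 : ℝ)..(ξ j - ξ k), v 0 ϑ = ξ j ^ 2 + ξ k ^ 2 := by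
    intro j k; rw [h1, h1]; ring
  simp only [morse, h2, morse1]
  rw [sum_sum_Ioi_add fun j => ξ j ^ 2, Finset.mul_sum, ← Finset.sum_add_distrib]
  refine Finset.sum_congr rfl fun j _ => ?_
  rw [shifted_add_one]
  push_cast
  ring

lemma mem_weights {m n : ℕ} {μ : Fin n → ℕ} :
    μ ∈ weights m n ↔ (∀ j, μ j ≤ m) ∧ Antitone μ := by
  simp [weights]

lemma shifted_lt {m n : ℕ} {μ : Fin n → ℕ} (hμ : μ ∈ weights m n) (j : Fin n) :
    shifted μ j < m + n := by
  have h := (mem_weights.1 hμ).1 j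
  have hj := j.2
  unfold shifted
  omega

lemma strictAnti_shifted {m n : ℕ} {μ : Fin n → ℕ} (hμ : μ ∈ weights m n) :
    StrictAnti (shifted μ) := by
  intro j k hjk
  have h := (mem_weights.1 hμ).2 hjk.le
  have h1 := k.2
  have h2 : (j : ℕ) < k := hjk
  unfold shifted
  omega

/-- The explicit node with label `lam`. -/
def rootVec {n : ℕ} (N : ℕ) (q0 q1 : ℝ) (l : Fin n → ℕ) (j : Fin n) : ℝ := root N q0 q1 (l j)

/-- A separable sum is minimal exactly when every summand is, and each summand has a strict minimum
at its root. -/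
lemma isNode_iff {m n : ℕ} (hq0 : q0 ∈ Set.Ioo (-1 : ℝ) 1) (hq1 : q1 ∈ Set.Ioo (-1 : ℝ) 1)
    {lam : Fin n → ℕ} (hlam : lam ∈ weights m n) (ξ : Fin n → ℝ) :
    IsNode m 0 q0 q1 lam ξ ↔ ξ = rootVec (m + n) q0 q1 (shifted lam) := by
  have hle : ∀ j, ∀ x : ℝ, morse1 (m + n) q0 q1 (shifted lam j)
      (rootVec (m + n) q0 q1 (shifted lam) j) ≤ morse1 (m + n) q0 q1 (shifted lam j) x := by
    intro j x
    by_cases hx : x = root (m + n) q0 q1 (shifted lam j)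
    · rw [hx]; exact le_rfl
    · exact (morse1_root_lt hq0 hq1 (shifted_lt hlam j) hx).le
  constructor
  · intro h
    have h1 := h (rootVec (m + n) q0 q1 (shifted lam))
    rw [morse_zero, morse_zero] at h1
    have h2 := (Finset.sum_eq_sum_iff_of_le fun j (_ : j ∈ Finset.univ) => hle j (ξ j)).1
      (le_antisymm (Finset.sum_le_sum fun j _ => hle j (ξ j)) h1)
    funext j
    by_contra hj
    exact (morse1_root_lt hq0 hq1 (shifted_lt hlam j) hj).ne (h2 j (Finset.mem_univ j))
  · rintro rfl η
    rw [morse_zero, morse_zero]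
    exact Finset.sum_le_sum fun j _ => hle j (η j)

lemma node_eq {m n : ℕ} (hq0 : q0 ∈ Set.Ioo (-1 : ℝ) 1) (hq1 : q1 ∈ Set.Ioo (-1 : ℝ) 1)
    {lam : Fin n → ℕ} (hlam : lam ∈ weights m n) :
    node m 0 q0 q1 lam = rootVec (m + n) q0 q1 (shifted lam) :=
  (isNode_iff hq0 hq1 hlam _).1
    (Classical.epsilon_spec ⟨_, (isNode_iff hq0 hq1 hlam _).2 rfl⟩)

lemma rootVec_mem_alcove {N n : ℕ} (hq0 : q0 ∈ Set.Ioo (-1 : ℝ) 1)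
    (hq1 : q1 ∈ Set.Ioo (-1 : ℝ) 1) {l : Fin n → ℕ} (hl : ∀ j, l j < N) (hanti : StrictAnti l) :
    rootVec N q0 q1 l ∈ alcove n :=
  ⟨fun j => root_mem_Ioo hq0 hq1 (hl j), fun _ _ hjk => root_lt_root hq0 hq1 (hl _) (hanti hjk)⟩

lemma const_mem_weights_one {N l : ℕ} (hl : l < N) :
    (fun _ : Fin 1 => l) ∈ weights (N - 1) 1 :=
  mem_weights.2 ⟨fun _ => by omega, fun _ _ _ => le_rfl⟩

lemma node1_eq {N l : ℕ} (hq0 : q0 ∈ Set.Ioo (-1 : ℝ) 1) (hq1 : q1 ∈ Set.Ioo (-1 : ℝ) 1)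
    (hl : l < N) : node1 N q0 q1 l = root N q0 q1 l := by
  rw [node1, node_eq hq0 hq1 (const_mem_weights_one hl)]
  simp [rootVec, shifted, Nat.sub_add_cancel (show 1 ≤ N by omega)]

/-! ### Trigonometry of the angle function -/

lemma exists_polar_one_sub_mul (hq : q ∈ Set.Ioo (-1 : ℝ) 1) (x : ℝ) :
    ∃ r : ℝ, r ≠ 0 ∧ r ^ 2 = quadDen q x ∧ r * Real.cos (phase q x) = 1 - q * Real.cos x ∧
      r * Real.sin (phase q x) = q * Real.sin x := by
  have hc := one_sub_mul_cos_pos hq x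
  have hw := quadDen_pos hq x
  have h3 : 1 + (q * Real.sin x / (1 - q * Real.cos x)) ^ 2 =
      quadDen q x / (1 - q * Real.cos x) ^ 2 := by
    unfold quadDen
    field_simp
    linear_combination q ^ 2 * Real.sin_sq_add_cos_sq x
  have hr := (Real.sqrt_pos.2 hw).ne'
  refine ⟨√(quadDen q x), hr, Real.sq_sqrt hw.le, ?_, ?_⟩
  · rw [phase, Real.cos_arctan, h3, Real.sqrt_div' _ (by positivity), Real.sqrt_sq hc.le]
    field_simp
  · rw [phase, Real.sin_arctan, h3, Real.sqrt_div' _ (by positivity), Real.sqrt_sq hc.le]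
    field_simp

/-- Real part of e^{iv} = (e^{ix} - q)/(1 - q e^{ix}), obtained by squaring the polar form of 1 - q
e^{-ix}. The next lemma is the imaginary part. -/
lemma quadDen_mul_cos_v (hq : q ∈ Set.Ioo (-1 : ℝ) 1) (x : ℝ) :
    quadDen q x * Real.cos (v q x) = (1 + q ^ 2) * Real.cos x - 2 * q := by
  obtain ⟨r, -, hr2, hc, hs⟩ := exists_polar_one_sub_mul hq x
  rw [v_eq hq, ← hr2, Real.cos_add, Real.cos_two_mul', Real.sin_two_mul]
  have : r ^ 2 * (Real.cos x * (Real.cos (phase q x) ^ 2 - Real.sin (phase q x) ^ 2) -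
      Real.sin x * (2 * Real.sin (phase q x) * Real.cos (phase q x))) =
      Real.cos x * ((r * Real.cos (phase q x)) ^ 2 - (r * Real.sin (phase q x)) ^ 2) -
      Real.sin x * (2 * (r * Real.sin (phase q x)) * (r * Real.cos (phase q x))) := by ring
  rw [this, hc, hs]
  linear_combination (q ^ 2 * Real.cos x - 2 * q) * Real.sin_sq_add_cos_sq x

lemma quadDen_mul_sin_v (hq : q ∈ Set.Ioo (-1 : ℝ) 1) (x : ℝ) :
    quadDen q x * Real.sin (v q x) = (1 - q ^ 2) * Real.sin x := by
  obtain ⟨r, -, hr2, hc, hs⟩ := exists_polar_one_sub_mul hq x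
  rw [v_eq hq, ← hr2, Real.sin_add, Real.cos_two_mul', Real.sin_two_mul]
  have : r ^ 2 * (Real.sin x * (Real.cos (phase q x) ^ 2 - Real.sin (phase q x) ^ 2) +
      Real.cos x * (2 * Real.sin (phase q x) * Real.cos (phase q x))) =
      Real.sin x * ((r * Real.cos (phase q x)) ^ 2 - (r * Real.sin (phase q x)) ^ 2) +
      Real.cos x * (2 * (r * Real.sin (phase q x)) * (r * Real.cos (phase q x))) := by ring
  rw [this, hc, hs]
  linear_combination (-q ^ 2 * Real.sin x) * Real.sin_sq_add_cos_sq x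

lemma sin_v (hq : q ∈ Set.Ioo (-1 : ℝ) 1) (x : ℝ) : Real.sin (v q x) = u q x * Real.sin x := by
  have hw := (quadDen_pos hq x).ne'
  rw [u_eq, div_mul_eq_mul_div, eq_div_iff hw, ← quadDen_mul_sin_v hq]
  ring

lemma v_two_pi_sub (hq : q ∈ Set.Ioo (-1 : ℝ) 1) (x : ℝ) :
    v q (2 * Real.pi - x) = 2 * Real.pi - v q x := by
  rw [v_eq hq, v_eq hq, phase, phase, Real.cos_two_pi_sub, Real.sin_two_pi_sub, mul_neg, neg_div,
    Real.arctan_neg]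
  ring

/-! ### Bernstein-Szegő functions -/

/-- The Bernstein-Szegő polynomial of degree `l`, multiplied by `2 sin x`. -/
def bernsteinSzego (q0 : ℝ) (l : ℕ) (x : ℝ) : ℝ :=
  2 * (Real.sin (((l : ℝ) + 1) * x) - q0 * Real.sin ((l : ℝ) * x))

lemma continuous_bernsteinSzego (q0 : ℝ) (l : ℕ) : Continuous (bernsteinSzego q0 l) := by
  unfold bernsteinSzego; fun_prop

lemma bernsteinSzego_zero (q0 x : ℝ) : bernsteinSzego q0 0 x = 2 * Real.sin x := by
  simp [bernsteinSzego]

lemma bernsteinSzego_one (q0 x : ℝ) :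
    bernsteinSzego q0 1 x = (2 * Real.cos x - q0) * bernsteinSzego q0 0 x := by
  have h : Real.sin (((1 : ℕ) + 1 : ℝ) * x) = 2 * Real.sin x * Real.cos x := by
    rw [← Real.sin_two_mul]; norm_num
  rw [bernsteinSzego_zero, bernsteinSzego, h]
  simp
  ring

lemma bernsteinSzego_add_two (q0 : ℝ) (l : ℕ) (x : ℝ) :
    bernsteinSzego q0 (l + 2) x =
      2 * Real.cos x * bernsteinSzego q0 (l + 1) x - bernsteinSzego q0 l x := by
  have h1 : ((l + 2 : ℕ) + 1 : ℝ) * x = ((l : ℝ) * x + x) + x + x := by push_cast; ring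
  have h2 : ((l + 2 : ℕ) : ℝ) * x = ((l : ℝ) * x + x) + x := by push_cast; ring
  have h3 : ((l + 1 : ℕ) + 1 : ℝ) * x = ((l : ℝ) * x + x) + x := by push_cast; ring
  have h4 : ((l + 1 : ℕ) : ℝ) * x = (l : ℝ) * x + x := by push_cast; ring
  have h5 : ((l : ℝ) + 1) * x = (l : ℝ) * x + x := by ring
  have key : ∀ t : ℝ, Real.sin (t + x + x) = 2 * Real.cos x * Real.sin (t + x) - Real.sin t := by
    intro t
    rw [Real.sin_add (t + x), Real.cos_add, Real.sin_add]
    linear_combination -Real.sin t * Real.sin_sq_add_cos_sq x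
  simp only [bernsteinSzego, h1, h2, h3, h4, h5]
  rw [key (l * x + x), key (l * x)]
  ring

/-- The Christoffel-Darboux formula. -/
lemma christoffel_darboux (q0 : ℝ) (N : ℕ) (x y : ℝ) :
    (2 * Real.cos x - 2 * Real.cos y) *
        ∑ l ∈ Finset.range (N + 1), bernsteinSzego q0 l x * bernsteinSzego q0 l y =
      bernsteinSzego q0 (N + 1) x * bernsteinSzego q0 N y -
        bernsteinSzego q0 N x * bernsteinSzego q0 (N + 1) y := by
  induction N with
  | zero =>
    simp only [zero_add, Finset.range_one, Finset.sum_singleton, bernsteinSzego_one]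
    ring
  | succ N ih =>
    rw [Finset.sum_range_succ, mul_add, ih, bernsteinSzego_add_two, bernsteinSzego_add_two]
    ring

/-- The factor sin x makes the sum of squared sines telescope, which yields the diagonal of the
Christoffel-Darboux kernel without a limit. -/
lemma sin_mul_sum_bernsteinSzego_sq (q0 : ℝ) (N : ℕ) (x : ℝ) :
    Real.sin x * ∑ l ∈ Finset.range N, bernsteinSzego q0 l x ^ 2 =
      2 * N * quadDen q0 x * Real.sin x - (Real.sin (2 * N * x + x) - Real.sin x
        - 2 * q0 * Real.sin (2 * N * x) + q0 ^ 2 * (Real.sin (2 * N * x - x) + Real.sin x)) := by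
  induction N with
  | zero => simp
  | succ N ih =>
    rw [Finset.sum_range_succ, mul_add, ih, bernsteinSzego]
    have h1 : 2 * ((N + 1 : ℕ) : ℝ) * x = 2 * ((N : ℝ) * x) + 2 * x := by push_cast; ring
    have h2 : ((N : ℝ) + 1) * x = (N : ℝ) * x + x := by ring
    have h3 : 2 * (N : ℝ) * x = 2 * ((N : ℝ) * x) := by ring
    rw [h1, h2, h3]
    generalize (N : ℝ) * x = t
    simp only [Real.sin_add, Real.cos_add, Real.sin_sub, Real.sin_two_mul, Real.cos_two_mul',
      quadDen]
    push_cast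
    have ht : Real.sin t ^ 2 = 1 - Real.cos t ^ 2 := Real.sin_sq t
    have hx : Real.sin x ^ 2 = 1 - Real.cos x ^ 2 := Real.sin_sq x
    have hx3 : Real.sin x ^ 3 = (1 - Real.cos x ^ 2) * Real.sin x := by rw [← hx]; ring
    ring_nf
    simp only [ht, hx, hx3]
    ring

/-- The node equation says that a quasi-orthogonal polynomial vanishes. -/
lemma bernsteinSzego_of_nodeFun {N l : ℕ} (hq0 : q0 ∈ Set.Ioo (-1 : ℝ) 1)
    (hq1 : q1 ∈ Set.Ioo (-1 : ℝ) 1) {x : ℝ}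
    (hx : nodeFun (N + 1) q0 q1 x = 2 * Real.pi * ((l : ℝ) + 1)) :
    bernsteinSzego q0 (N + 1) x = q1 * bernsteinSzego q0 N x := by
  obtain ⟨r, hr, -, hc, hs⟩ := exists_polar_one_sub_mul hq0 x
  obtain ⟨r', hr', -, hc', hs'⟩ := exists_polar_one_sub_mul hq1 x
  -- Half of the node equation says that (N+2)x + arg(1 - q₀e^{-ix}) + arg(1 - q₁e^{-ix}) is a
  -- multiple of π. Hence e^{i(N+2)x}(1 - q₀e^{-ix})(1 - q₁e^{-ix}) is real, and its imaginary part
  -- is half of b_{N+1} - q₁ b_N.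
  have h0 : Real.sin ((N : ℝ) * x + x + x + (phase q0 x + phase q1 x)) = 0 := by
    rw [nodeFun, v_eq hq0, v_eq hq1] at hx
    have : (N : ℝ) * x + x + x + (phase q0 x + phase q1 x) = ((l + 1 : ℕ) : ℝ) * Real.pi := by
      push_cast at hx ⊢
      linarith
    rw [this, Real.sin_nat_mul_pi]
  have h1 : ((N + 1 : ℕ) + 1 : ℝ) * x = (N : ℝ) * x + x + x := by push_cast; ring
  have h2 : ((N + 1 : ℕ) : ℝ) * x = (N : ℝ) * x + x := by push_cast; ring
  have h3 : ((N : ℝ) + 1) * x = (N : ℝ) * x + x := by ring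
  simp only [bernsteinSzego, h1, h2, h3]
  generalize (N : ℝ) * x = t at *
  have h4 : Real.sin (t + x + x) *
      ((r * Real.cos (phase q0 x)) * (r' * Real.cos (phase q1 x)) -
        (r * Real.sin (phase q0 x)) * (r' * Real.sin (phase q1 x))) +
      Real.cos (t + x + x) * ((r * Real.sin (phase q0 x)) * (r' * Real.cos (phase q1 x)) +
        (r * Real.cos (phase q0 x)) * (r' * Real.sin (phase q1 x))) = 0 := by
    rw [Real.sin_add, Real.cos_add (phase q0 x), Real.sin_add (phase q0 x)] at h0
    linear_combination r * r' * h0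
  rw [hc, hc', hs, hs'] at h4
  have hx2 : Real.sin x ^ 2 = 1 - Real.cos x ^ 2 := Real.sin_sq x
  have hx3 : Real.sin x ^ 3 = (1 - Real.cos x ^ 2) * Real.sin x := by rw [← hx2]; ring
  simp only [Real.sin_add, Real.cos_add] at h4 ⊢
  rw [← sub_eq_zero]
  refine Eq.trans ?_ (congrArg (fun z => 2 * z) h4 |>.trans (mul_zero 2))
  ring_nf
  simp only [hx2, hx3, show Real.sin x ^ 4 = (1 - Real.cos x ^ 2) ^ 2 by rw [← hx2]; ring]
  ring

/-- Substituting b_N = q₁ b_{N-1} at both points makes the two terms on the right of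
Christoffel-Darboux cancel. -/
lemma sum_bernsteinSzego_mul_of_nodeFun {N k l : ℕ} (hq0 : q0 ∈ Set.Ioo (-1 : ℝ) 1)
    (hq1 : q1 ∈ Set.Ioo (-1 : ℝ) 1) {x y : ℝ}
    (hx : nodeFun N q0 q1 x = 2 * Real.pi * ((k : ℝ) + 1))
    (hy : nodeFun N q0 q1 y = 2 * Real.pi * ((l : ℝ) + 1)) (hxy : Real.cos x ≠ Real.cos y) :
    ∑ j ∈ Finset.range N, bernsteinSzego q0 j x * bernsteinSzego q0 j y = 0 := by
  obtain _ | N := N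
  · simp
  have h := christoffel_darboux q0 N x y
  rw [bernsteinSzego_of_nodeFun hq0 hq1 hx, bernsteinSzego_of_nodeFun hq0 hq1 hy] at h
  refine (mul_eq_zero.1 (h.trans (by ring))).resolve_left fun h' => hxy ?_
  linarith

lemma sum_bernsteinSzego_sq_of_nodeFun {N l : ℕ} (hq0 : q0 ∈ Set.Ioo (-1 : ℝ) 1)
    (hq1 : q1 ∈ Set.Ioo (-1 : ℝ) 1) {x : ℝ}
    (hx : nodeFun N q0 q1 x = 2 * Real.pi * ((l : ℝ) + 1)) (hs : Real.sin x ≠ 0) :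
    ∑ j ∈ Finset.range N, bernsteinSzego q0 j x ^ 2 =
      quadDen q0 x * (2 * (N : ℝ) + u q0 x + u q1 x) := by
  refine mul_left_cancel₀ hs ?_
  -- The boundary terms of the telescoped sum combine into (1 - 2q₀ cos x + q₀²) sin(2Nx +
  -- v_{q₀}(x)). At a node this sine is -sin v_{q₁}(x) = -u_{q₁}(x) sin x, the source of the `u q1`
  -- term.
  have h0 : Real.sin (2 * N * x + v q0 x) = -Real.sin (v q1 x) := by
    rw [show 2 * N * x + v q0 x = ((l + 1 : ℕ) : ℝ) * (2 * Real.pi) - v q1 x by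
      rw [nodeFun] at hx; push_cast; linarith, Real.sin_nat_mul_two_pi_sub]
  rw [Real.sin_add, sin_v hq1] at h0
  rw [sin_mul_sum_bernsteinSzego_sq, Real.sin_add, Real.sin_sub]
  have h1 := quadDen_mul_cos_v hq0 x
  have h2 := quadDen_mul_sin_v hq0 x
  have h3 : quadDen q0 x * u q0 x = 1 - q0 ^ 2 := by
    rw [u_eq, mul_div_cancel₀ _ (quadDen_pos hq0 x).ne']
  linear_combination (-quadDen q0 x) * h0 + Real.sin (2 * N * x) * h1 +
    Real.cos (2 * N * x) * h2 - Real.sin x * h3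

/-! ### Continuous orthogonality -/

/-- Thus e^{iv} is the boundary value of the Blaschke factor (z - q)/(1 - qz), holomorphic near the
closed unit disc. -/
lemma exp_v (hq : q ∈ Set.Ioo (-1 : ℝ) 1) (x : ℝ) :
    (1 - q * Complex.exp (x * Complex.I)) * Complex.exp (v q x * Complex.I) =
      Complex.exp (x * Complex.I) - q := by
  have hw : (quadDen q x : ℂ) ≠ 0 := Complex.ofReal_ne_zero.2 (quadDen_pos hq x).ne'
  have hc := congrArg Complex.ofReal (quadDen_mul_cos_v hq x)
  have hs := congrArg Complex.ofReal (quadDen_mul_sin_v hq x)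
  refine mul_left_cancel₀ hw ?_
  rw [Complex.exp_mul_I, Complex.exp_mul_I]
  simp only [quadDen] at hc hs ⊢
  push_cast at hc hs ⊢
  have h1 := Complex.sin_sq_add_cos_sq (x : ℂ)
  have hI := Complex.I_sq
  linear_combination (1 - q * (Complex.cos x + Complex.sin x * Complex.I)) *
    (hc + Complex.I * hs) + (q - q ^ 3) * h1 - (q - q ^ 3) * Complex.sin x ^ 2 * hI

/-- The integrand is the real part on the unit circle of z^{M+1}(z - q)/(1 - qz), which vanishes at
0, so its mean over the circle is 0. The reflection x ↦ 2π - x shows that the half circle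
contributes half of it. -/
lemma integral_cos_mul_add_v (hq : q ∈ Set.Ioo (-1 : ℝ) 1) (M : ℕ) :
    ∫ x in (0 : ℝ)..Real.pi, Real.cos (((M : ℝ) + 1) * x + v q x) = 0 := by
  have hq1 : |q| < 1 := abs_lt.2 hq
  have hne : ∀ z ∈ Metric.closedBall (0 : ℂ) |1|, 1 - (q : ℂ) * z ≠ 0 := by
    intro z hz h
    have h1 : ‖(q : ℂ) * z‖ = 1 := by rw [← sub_eq_zero.1 h, norm_one]
    rw [norm_mul, Complex.norm_real, Real.norm_eq_abs] at h1
    have h2 : ‖z‖ ≤ 1 := by simpa using hz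
    nlinarith [norm_nonneg z, abs_nonneg q]
  have hG : Real.circleAverage (fun z : ℂ => z ^ (M + 1) * ((z - q) / (1 - q * z))) 0 1 = 0 := by
    rw [DiffContOnCl.circleAverage]
    · simp
    · refine DifferentiableOn.diffContOnCl_ball (U := Metric.closedBall 0 |1|) ?_ subset_rfl
      exact (differentiableOn_id.pow _).mul ((differentiableOn_id.sub_const _).div
        ((differentiableOn_const _).sub (differentiableOn_id.const_mul _)) hne)
  have hexp : ∀ x : ℝ, (fun z : ℂ => z ^ (M + 1) * ((z - q) / (1 - q * z))) (circleMap 0 1 x) =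
      Complex.exp (((((M : ℝ) + 1) * x + v q x : ℝ) : ℂ) * Complex.I) := by
    intro x
    have h1 : circleMap 0 1 x = Complex.exp (x * Complex.I) := by simp [circleMap]
    have h2 := hne (Complex.exp (x * Complex.I)) (by simp [Complex.norm_exp_ofReal_mul_I])
    simp only [h1]
    rw [← exp_v hq x, mul_div_cancel_left₀ _ h2, ← Complex.exp_nat_mul, ← Complex.exp_add]
    congr 1
    push_cast
    ring
  have hcont : Continuous fun x : ℝ => ((M : ℝ) + 1) * x + v q x :=
    (continuous_const.mul continuous_id).add (continuous_v hq)
  have hint : ∀ a b : ℝ, IntervalIntegrable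
      (fun x : ℝ => Real.cos (((M : ℝ) + 1) * x + v q x)) volume a b := fun a b =>
    (Real.continuous_cos.comp hcont).intervalIntegrable a b
  have h2pi : ∫ x in (0 : ℝ)..2 * Real.pi, Real.cos (((M : ℝ) + 1) * x + v q x) = 0 := by
    rw [Real.circleAverage_def] at hG
    simp only [hexp] at hG
    have h0 := (smul_eq_zero.1 hG).resolve_left (by positivity)
    have h1 := congrArg Complex.re h0
    rw [← Complex.reCLM_apply, ← ContinuousLinearMap.intervalIntegral_comp_comm] at h1
    · simpa only [Complex.reCLM_apply, Complex.exp_ofReal_mul_I_re, Complex.zero_re] using h1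
    · exact (Complex.continuous_exp.comp
        ((Complex.continuous_ofReal.comp hcont).mul continuous_const)).intervalIntegrable _ _
  have hrefl : ∫ x in Real.pi..2 * Real.pi, Real.cos (((M : ℝ) + 1) * x + v q x) =
      ∫ x in (0 : ℝ)..Real.pi, Real.cos (((M : ℝ) + 1) * x + v q x) := by
    have h := intervalIntegral.integral_comp_sub_left (a := 0) (b := Real.pi)
      (fun x : ℝ => Real.cos (((M : ℝ) + 1) * x + v q x)) (2 * Real.pi)
    rw [show 2 * Real.pi - Real.pi = Real.pi by ring, sub_zero] at h
    rw [← h]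
    refine intervalIntegral.integral_congr fun x _ => ?_
    rw [v_two_pi_sub hq, show ((M : ℝ) + 1) * (2 * Real.pi - x) + (2 * Real.pi - v q x) =
      ((M + 2 : ℕ) : ℝ) * (2 * Real.pi) - (((M : ℝ) + 1) * x + v q x) by push_cast; ring,
      Real.cos_nat_mul_two_pi_sub]
  have hadd := intervalIntegral.integral_add_adjacent_intervals (hint 0 Real.pi)
    (hint Real.pi (2 * Real.pi))
  rw [hrefl, h2pi] at hadd
  linarith

/-- With φ = arg(1 - q₀e^{-ix}), b_l is 2|1 - q₀e^{-ix}| sin((l+1)x + φ). The product-to-sum formula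
then applies, and 2φ + x = v_{q₀}(x). -/
lemma bernsteinSzego_mul_div (hq0 : q0 ∈ Set.Ioo (-1 : ℝ) 1) (k l : ℕ) (x : ℝ) :
    bernsteinSzego q0 k x * bernsteinSzego q0 l x / quadDen q0 x =
      2 * Real.cos (((k : ℝ) - l) * x) -
        2 * Real.cos ((((k + l : ℕ) : ℝ) + 1) * x + v q0 x) := by
  have hw := (quadDen_pos hq0 x).ne'
  have hc := quadDen_mul_cos_v hq0 x
  have hs := quadDen_mul_sin_v hq0 x
  rw [div_eq_iff hw]
  have h1 : (((k + l : ℕ) : ℝ) + 1) * x = k * x + l * x + x := by push_cast; ring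
  have h2 : ((k : ℝ) - l) * x = k * x - l * x := by ring
  have h3 : ((k : ℝ) + 1) * x = k * x + x := by ring
  have h4 : ((l : ℝ) + 1) * x = l * x + x := by ring
  rw [bernsteinSzego, bernsteinSzego, h1, h2, h3, h4, Real.cos_add _ (v q0 x)]
  generalize (k : ℝ) * x = s
  generalize (l : ℝ) * x = t
  have hx2 : Real.sin x ^ 2 = 1 - Real.cos x ^ 2 := Real.sin_sq x
  have key : 2 * (Real.sin (s + x) - q0 * Real.sin s) * (2 * (Real.sin (t + x) - q0 * Real.sin t))
      = 2 * Real.cos (s - t) * quadDen q0 x - 2 * (Real.cos (s + t + x) *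
        ((1 + q0 ^ 2) * Real.cos x - 2 * q0) -
        Real.sin (s + t + x) * ((1 - q0 ^ 2) * Real.sin x)) := by
    simp only [Real.sin_add, Real.cos_add, Real.cos_sub, quadDen]
    ring_nf
    simp only [hx2]
    ring
  rw [key, ← hc, ← hs]
  ring

lemma integral_bernsteinSzego_mul (hq0 : q0 ∈ Set.Ioo (-1 : ℝ) 1) (k l : ℕ) :
    ∫ x in (0 : ℝ)..Real.pi, bernsteinSzego q0 k x * bernsteinSzego q0 l x / quadDen q0 x =
      if k = l then 2 * Real.pi else 0 := by
  have hcont : Continuous fun x : ℝ =>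
      2 * Real.cos ((((k + l : ℕ) : ℝ) + 1) * x + v q0 x) :=
    continuous_const.mul (Real.continuous_cos.comp
      ((continuous_const.mul continuous_id).add (continuous_v hq0)))
  simp only [bernsteinSzego_mul_div hq0]
  rw [intervalIntegral.integral_sub (Continuous.intervalIntegrable (by fun_prop) _ _)
    (hcont.intervalIntegrable _ _), intervalIntegral.integral_const_mul,
    intervalIntegral.integral_const_mul, integral_cos_mul_add_v hq0]
  split_ifs with h
  · subst h; simp
  · have hkl : (k : ℝ) - l ≠ 0 := sub_ne_zero.2 (by exact_mod_cast h)
    rw [intervalIntegral.integral_comp_mul_left (fun x => Real.cos x) hkl, integral_cos]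
    have : Real.sin (((k : ℝ) - l) * Real.pi) = 0 := by
      simpa using Real.sin_int_mul_pi ((k : ℤ) - l)
    simp [this]

/-! ### Discrete orthogonality and the one-variable quadrature rule -/

/-- The reciprocal quadrature weight for the functions `bernsteinSzego`. -/
def kernelDiag (N : ℕ) (q0 x : ℝ) : ℝ := ∑ j ∈ Finset.range N, bernsteinSzego q0 j x ^ 2

lemma sin_root_pos {N l : ℕ} (hq0 : q0 ∈ Set.Ioo (-1 : ℝ) 1) (hq1 : q1 ∈ Set.Ioo (-1 : ℝ) 1)
    (hl : l < N) : 0 < Real.sin (root N q0 q1 l) :=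
  Real.sin_pos_of_mem_Ioo (root_mem_Ioo hq0 hq1 hl)

lemma kernelDiag_root {N l : ℕ} (hq0 : q0 ∈ Set.Ioo (-1 : ℝ) 1) (hq1 : q1 ∈ Set.Ioo (-1 : ℝ) 1)
    (hl : l < N) : kernelDiag N q0 (root N q0 q1 l) = quadDen q0 (root N q0 q1 l) *
      (2 * (N : ℝ) + u q0 (root N q0 q1 l) + u q1 (root N q0 q1 l)) :=
  sum_bernsteinSzego_sq_of_nodeFun hq0 hq1 (nodeFun_root hq0 hq1 hl) (sin_root_pos hq0 hq1 hl).ne'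

lemma kernelDiag_root_pos {N l : ℕ} (hq0 : q0 ∈ Set.Ioo (-1 : ℝ) 1)
    (hq1 : q1 ∈ Set.Ioo (-1 : ℝ) 1) (hl : l < N) : 0 < kernelDiag N q0 (root N q0 q1 l) := by
  rw [kernelDiag_root hq0 hq1 hl]
  exact mul_pos (quadDen_pos hq0 _) (nodeFun_deriv_pos N hq0 hq1 _)

lemma sum_bernsteinSzego_root {N k l : ℕ} (hq0 : q0 ∈ Set.Ioo (-1 : ℝ) 1)
    (hq1 : q1 ∈ Set.Ioo (-1 : ℝ) 1) (hk : k < N) (hl : l < N) :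
    ∑ j ∈ Finset.range N, bernsteinSzego q0 j (root N q0 q1 k) *
      bernsteinSzego q0 j (root N q0 q1 l) =
      if k = l then kernelDiag N q0 (root N q0 q1 k) else 0 := by
  split_ifs with h
  · subst h
    simp only [kernelDiag, sq]
  · refine sum_bernsteinSzego_mul_of_nodeFun hq0 hq1 (nodeFun_root hq0 hq1 hk)
      (nodeFun_root hq0 hq1 hl) fun hc => h ?_
    exact root_injOn hq0 hq1 hk hl (Real.injOn_cos
      (Set.Ioo_subset_Icc_self (root_mem_Ioo hq0 hq1 hk))
      (Set.Ioo_subset_Icc_self (root_mem_Ioo hq0 hq1 hl)) hc)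

/-- Orthogonality over degrees says that the weighted transpose `B` is a left inverse of the square
matrix `A` of values. It is then also a right inverse, which is orthogonality over roots. -/
lemma sum_root_bernsteinSzego_mul {N k l : ℕ} (hq0 : q0 ∈ Set.Ioo (-1 : ℝ) 1)
    (hq1 : q1 ∈ Set.Ioo (-1 : ℝ) 1) (hk : k < N) (hl : l < N) :
    ∑ j ∈ Finset.range N, bernsteinSzego q0 k (root N q0 q1 j) *
      bernsteinSzego q0 l (root N q0 q1 j) / kernelDiag N q0 (root N q0 q1 j) =
      if k = l then 1 else 0 := by
  let A : Matrix (Fin N) (Fin N) ℝ := fun i j => bernsteinSzego q0 i (root N q0 q1 j)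
  let B : Matrix (Fin N) (Fin N) ℝ :=
    fun j i => bernsteinSzego q0 i (root N q0 q1 j) / kernelDiag N q0 (root N q0 q1 j)
  have hBA : B * A = 1 := by
    ext i j
    have h := sum_bernsteinSzego_root hq0 hq1 i.2 j.2
    rw [Finset.sum_range] at h
    have h1 : (B * A) i j = (∑ a : Fin N, bernsteinSzego q0 a (root N q0 q1 i) *
        bernsteinSzego q0 a (root N q0 q1 j)) / kernelDiag N q0 (root N q0 q1 i) := by
      rw [Matrix.mul_apply, Finset.sum_div]
      exact Finset.sum_congr rfl fun a _ => by simp only [A, B]; ring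
    rw [h1, h, Matrix.one_apply]
    by_cases hij : i = j
    · simp [hij, (kernelDiag_root_pos hq0 hq1 j.2).ne']
    · simp [hij, Fin.val_ne_of_ne hij]
  have hAB' : A * B = 1 := mul_eq_one_comm.1 hBA
  have hAB := congrFun (congrFun hAB' ⟨k, hk⟩) ⟨l, hl⟩
  rw [Matrix.mul_apply, Matrix.one_apply] at hAB
  rw [Finset.sum_range]
  simpa [A, B, mul_div_assoc] using hAB

lemma cos_pow_mul_sin_mem_span (q0 : ℝ) (k : ℕ) :
    (fun x => Real.cos x ^ k * (2 * Real.sin x)) ∈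
      Submodule.span ℝ (bernsteinSzego q0 '' Set.Iic k) := by
  induction k with
  | zero =>
    refine Submodule.subset_span ⟨0, Set.mem_Iic.2 le_rfl, ?_⟩
    funext x
    simp [bernsteinSzego_zero]
  | succ k ih =>
    let T : (ℝ → ℝ) →ₗ[ℝ] (ℝ → ℝ) := LinearMap.mulLeft ℝ Real.cos
    have hT : Submodule.span ℝ (bernsteinSzego q0 '' Set.Iic k) ≤
        (Submodule.span ℝ (bernsteinSzego q0 '' Set.Iic (k + 1))).comap T := by
      rw [Submodule.span_le]
      rintro _ ⟨j, hj, rfl⟩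
      rw [Set.mem_Iic] at hj
      have hmem : ∀ i ≤ k + 1, bernsteinSzego q0 i ∈
          Submodule.span ℝ (bernsteinSzego q0 '' Set.Iic (k + 1)) := fun i hi =>
        Submodule.subset_span ⟨i, hi, rfl⟩
      -- The three-term recurrence solved for cos x · b_j. At j = 0 there is no b_{-1}; there b_1 =
      -- (2 cos x - q₀) b_0 supplies the other term.
      have hTj : T (bernsteinSzego q0 j) = (1 / 2 : ℝ) • bernsteinSzego q0 (j + 1) +
          (if j = 0 then (q0 / 2) • bernsteinSzego q0 0
            else (1 / 2 : ℝ) • bernsteinSzego q0 (j - 1)) := by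
        funext x
        obtain _ | j := j
        · simp [T, bernsteinSzego_one]; ring
        · simp [T, bernsteinSzego_add_two]; ring
      rw [SetLike.mem_coe, Submodule.mem_comap, hTj]
      refine add_mem (Submodule.smul_mem _ _ (hmem _ (by omega))) ?_
      split_ifs
      · exact Submodule.smul_mem _ _ (hmem _ (by omega))
      · exact Submodule.smul_mem _ _ (hmem _ (by omega))
    have h := hT ih
    rw [Submodule.mem_comap] at h
    convert! h using 1
    funext x
    simp [T]
    ring

/-- The one-variable quadrature rule with weight `4 sin² x / (1 - 2 q₀ cos x + q₀²)`. -/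
lemma quadrature_one (N : ℕ) (hq0 : q0 ∈ Set.Ioo (-1 : ℝ) 1) (hq1 : q1 ∈ Set.Ioo (-1 : ℝ) 1)
    {k : ℕ} (hk : k + 2 ≤ 2 * N) :
    ∫ x in (0 : ℝ)..Real.pi, Real.cos x ^ k * (4 * Real.sin x ^ 2) / quadDen q0 x =
      2 * Real.pi * ∑ j ∈ Finset.range N, Real.cos (root N q0 q1 j) ^ k *
        (4 * Real.sin (root N q0 q1 j) ^ 2) / kernelDiag N q0 (root N q0 q1 j) := by
  let V : Submodule ℝ (ℝ → ℝ) := Submodule.span ℝ (bernsteinSzego q0 '' Set.Iio N)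
  have hV : ∀ j < N, (fun x => Real.cos x ^ j * (2 * Real.sin x)) ∈ V := fun j hj =>
    Submodule.span_mono (Set.image_mono fun i (hi : i ≤ j) => lt_of_le_of_lt hi hj)
      (cos_pow_mul_sin_mem_span q0 j)
  have hVc : ∀ f ∈ V, Continuous f := by
    intro f hf
    induction hf using Submodule.span_induction with
    | mem f hf => obtain ⟨j, -, rfl⟩ := hf; exact continuous_bernsteinSzego q0 j
    | zero => exact continuous_zero
    | add f g _ _ hf hg => exact hf.add hg
    | smul a f _ hf => exact hf.const_smul a
  have hint : ∀ f ∈ V, ∀ g ∈ V, IntervalIntegrable (fun x => f x * g x / quadDen q0 x)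
      volume 0 Real.pi := fun f hf g hg =>
    (((hVc f hf).mul (hVc g hg)).div (continuous_quadDen q0)
      fun x => (quadDen_pos hq0 x).ne').intervalIntegrable _ _
  -- Both sides are bilinear in (f, g), so it suffices to compare the continuous and discrete
  -- orthogonality relations on the spanning functions.
  have main : ∀ f ∈ V, ∀ g ∈ V, ∫ x in (0 : ℝ)..Real.pi, f x * g x / quadDen q0 x =
      2 * Real.pi * ∑ j ∈ Finset.range N, f (root N q0 q1 j) * g (root N q0 q1 j) /
        kernelDiag N q0 (root N q0 q1 j) := by
    intro f hf g hg
    induction hf, hg using Submodule.span_induction₂ with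
    | mem_mem f g hf hg =>
      obtain ⟨i, hi, rfl⟩ := hf
      obtain ⟨j, hj, rfl⟩ := hg
      rw [integral_bernsteinSzego_mul hq0, sum_root_bernsteinSzego_mul hq0 hq1 hi hj]
      split_ifs <;> simp
    | zero_left => simp
    | zero_right => simp
    | add_left f f' g hf hf' hg h h' =>
      simp only [Pi.add_apply, add_mul, add_div]
      rw [intervalIntegral.integral_add (hint f hf g hg) (hint f' hf' g hg), h, h',
        Finset.sum_add_distrib, mul_add]
    | add_right f g g' hf hg hg' h h' =>
      simp only [Pi.add_apply, mul_add, add_div]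
      rw [intervalIntegral.integral_add (hint f hf g hg) (hint f hf g' hg'), h, h',
        Finset.sum_add_distrib, mul_add]
    | smul_left r f g hf hg h =>
      simp only [Pi.smul_apply, smul_eq_mul, mul_assoc, mul_div_assoc] at h ⊢
      rw [intervalIntegral.integral_const_mul, h, ← Finset.mul_sum]
      ring
    | smul_right r f g hf hg h =>
      simp only [Pi.smul_apply, smul_eq_mul, mul_left_comm _ r, mul_div_assoc] at h ⊢
      rw [intervalIntegral.integral_const_mul, h, ← Finset.mul_sum]
      ring
  -- Since k ≤ 2N - 2, both halves k/2 and k - k/2 are below N.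
  have h := main _ (hV (k / 2) (by omega)) _ (hV (k - k / 2) (by omega))
  have e : ∀ x : ℝ, Real.cos x ^ (k / 2) * (2 * Real.sin x) *
      (Real.cos x ^ (k - k / 2) * (2 * Real.sin x)) = Real.cos x ^ k * (4 * Real.sin x ^ 2) := by
    intro x
    conv_rhs => rw [← Nat.add_sub_of_le (Nat.div_le_self k 2), pow_add]
    ring
  simpa only [e] using h

/-! ### The Weyl denominator -/

/-- The type `C` Weyl denominator (up to a power of the imaginary unit). -/
def weylDenom (ξ : Fin n → ℝ) : ℝ :=
  (∏ j, 2 * Real.sin (ξ j)) *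
    ∏ j, ∏ k ∈ Finset.Ioi j, (2 * Real.cos (ξ j) - 2 * Real.cos (ξ k))

lemma weylDenom_sq (ξ : Fin n → ℝ) : weylDenom ξ ^ 2 = rho ξ := by
  have h1 : ∀ j, (2 * Real.sin (ξ j)) ^ 2 = 2 ^ 2 * (1 - Real.cos (ξ j) ^ 2) := by
    intro j; rw [mul_pow, Real.sin_sq]
  have h2 : ∀ j k, (2 * Real.cos (ξ j) - 2 * Real.cos (ξ k)) ^ 2 =
      2 ^ 2 * (Real.cos (ξ j) - Real.cos (ξ k)) ^ 2 := by
    intro j k; ring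
  have h3 : (∏ j : Fin n, ∏ k ∈ Finset.Ioi j, (2 : ℝ) ^ 2) = 2 ^ (n * (n - 1)) := by
    simp only [Finset.prod_const, Fin.card_Ioi, ← pow_mul]
    rw [Finset.prod_pow_eq_pow_sum, ← Finset.mul_sum,
      Fin.sum_univ_eq_sum_range (fun i => n - 1 - i) n,
      Finset.sum_range_reflect (fun i => i) n, mul_comm, Finset.sum_range_id_mul_two]
  rw [weylDenom, mul_pow, ← Finset.prod_pow, ← Finset.prod_pow]
  simp only [← Finset.prod_pow, h1, h2, Finset.prod_mul_distrib]
  rw [h3, rho]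
  have h4 : (∏ _j : Fin n, (2 : ℝ) ^ 2) * 2 ^ (n * (n - 1)) = 2 ^ (n * (n + 1)) := by
    rw [Finset.prod_const, Finset.card_univ, Fintype.card_fin, ← pow_mul, ← pow_add]
    congr 1
    obtain _ | n := n
    · rfl
    · simp only [Nat.add_sub_cancel]; ring
  rw [← h4]
  ring

lemma prod_prod_Ioi_sub_perm (c : Fin n → ℝ) (σ : Equiv.Perm (Fin n)) :
    ∏ j, ∏ k ∈ Finset.Ioi j, (c (σ j) - c (σ k)) =
      (Equiv.Perm.sign σ : ℤ) * ∏ j, ∏ k ∈ Finset.Ioi j, (c j - c k) := by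
  have h : ∀ d : Fin n → ℝ, ∏ j, ∏ k ∈ Finset.Ioi j, (d j - d k) =
      (Matrix.vandermonde fun i => -d i).det := by
    intro d
    rw [Matrix.det_vandermonde]
    exact Finset.prod_congr rfl fun j _ => Finset.prod_congr rfl fun k _ => by ring
  rw [h c, h fun j => c (σ j), ← Matrix.det_permute]
  rfl

lemma cos_units_mul (ε : ℤˣ) (x : ℝ) : Real.cos (((ε : ℤ) : ℝ) * x) = Real.cos x := by
  rcases Int.units_eq_one_or ε with rfl | rfl <;> simp

lemma sin_units_mul (ε : ℤˣ) (x : ℝ) :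
    Real.sin (((ε : ℤ) : ℝ) * x) = ((ε : ℤ) : ℝ) * Real.sin x := by
  rcases Int.units_eq_one_or ε with rfl | rfl <;> simp

/-- Anti-invariance under the hyperoctahedral group: dividing by the Weyl denominator turns the
symmetrization defining P_μ into an antisymmetrization. -/
lemma weylDenom_signedPerm (σ : Equiv.Perm (Fin n)) (ε : Fin n → ℤˣ) (ξ : Fin n → ℝ) :
    weylDenom (signedPerm σ ε ξ) =
      (Equiv.Perm.sign σ : ℤ) * (∏ j, ((ε j : ℤ) : ℝ)) * weylDenom ξ := by
  simp only [weylDenom, signedPerm, cos_units_mul, sin_units_mul]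
  rw [prod_prod_Ioi_sub_perm (fun j => 2 * Real.cos (ξ j)) σ]
  have h : ∏ j, 2 * (((ε j : ℤ) : ℝ) * Real.sin (ξ (σ j))) =
      (∏ j, ((ε j : ℤ) : ℝ)) * ∏ j, 2 * Real.sin (ξ j) := by
    rw [← Equiv.prod_comp σ fun j => 2 * Real.sin (ξ j), ← Finset.prod_mul_distrib]
    exact Finset.prod_congr rfl fun j _ => by ring
  rw [h]
  ring

/-! ### Hall-Littlewood polynomials at `q = 0` -/

/-- Each pair leaves a factor e^{ia} on its smaller index, the origin of the staircase shift of the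
labels. No condition is needed on the walls, since both sides are then 0 by the convention for
division by zero. -/
lemma one_div_one_sub_exp_sub_mul (a b : ℂ) :
    1 / (1 - Complex.exp (-Complex.I * (a - b))) * (1 / (1 - Complex.exp (-Complex.I * (a + b)))) =
      Complex.exp (Complex.I * a) / (2 * Complex.cos a - 2 * Complex.cos b) := by
  have h : (1 - Complex.exp (-Complex.I * (a - b))) * (1 - Complex.exp (-Complex.I * (a + b))) =
      Complex.exp (-(Complex.I * a)) * (2 * Complex.cos a - 2 * Complex.cos b) := by
    have e1 : Complex.exp (-Complex.I * (a - b)) =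
        Complex.exp (-(Complex.I * a)) * Complex.exp (Complex.I * b) := by
      rw [← Complex.exp_add]; congr 1; ring
    have e2 : Complex.exp (-Complex.I * (a + b)) =
        Complex.exp (-(Complex.I * a)) * Complex.exp (-(Complex.I * b)) := by
      rw [← Complex.exp_add]; congr 1; ring
    have e3 : Complex.exp (-(Complex.I * a)) * Complex.exp (Complex.I * a) = 1 := by
      rw [← Complex.exp_add]; simp
    have e4 : Complex.exp (-(Complex.I * b)) * Complex.exp (Complex.I * b) = 1 := by
      rw [← Complex.exp_add]; simp
    rw [e1, e2, Complex.two_cos, Complex.two_cos]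
    simp only [neg_mul, mul_comm a, mul_comm b]
    linear_combination (Complex.exp (-(Complex.I * a))) ^ 2 * e4 - e3
  rw [div_mul_div_comm, one_mul, h, Complex.exp_neg, one_div, mul_inv, inv_inv, div_eq_mul_inv]

lemma one_div_one_sub_exp_two_mul (a : ℂ) :
    1 / (1 - Complex.exp (-2 * Complex.I * a)) =
      Complex.exp (Complex.I * a) / (Complex.I * (2 * Complex.sin a)) := by
  have h : 1 - Complex.exp (-2 * Complex.I * a) =
      Complex.exp (-(Complex.I * a)) * (Complex.I * (2 * Complex.sin a)) := by
    have e1 : Complex.exp (-2 * Complex.I * a) =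
        Complex.exp (-(Complex.I * a)) * Complex.exp (-(Complex.I * a)) := by
      rw [← Complex.exp_add]; congr 1; ring
    have e3 : Complex.exp (-(Complex.I * a)) * Complex.exp (Complex.I * a) = 1 := by
      rw [← Complex.exp_add]; simp
    rw [e1, Complex.two_sin]
    simp only [neg_mul, mul_comm a]
    linear_combination -e3 - Complex.exp (-(Complex.I * a)) * (Complex.exp (-(Complex.I * a)) -
      Complex.exp (Complex.I * a)) * Complex.I_sq
  rw [h, Complex.exp_neg, one_div, mul_inv, inv_inv, div_eq_mul_inv]

/-- The exponent n - 1 - j + 1 counts the pairs in which j is the smaller index, plus one for the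
single-variable factor. -/
lemma cFun_zero (q0 : ℝ) (ξ : Fin n → ℝ) :
    cFun 0 q0 ξ = (∏ j, (1 - (q0 : ℂ) * Complex.exp (-Complex.I * (ξ j : ℂ))) *
      Complex.exp (Complex.I * (ξ j : ℂ)) ^ (n - 1 - (j : ℕ) + 1)) /
      (Complex.I ^ n * (weylDenom ξ : ℂ)) := by
  have h1 : ∀ j : Fin n, (1 - (q0 : ℂ) * Complex.exp (-Complex.I * (ξ j : ℂ))) /
      (1 - Complex.exp (-2 * Complex.I * (ξ j : ℂ))) =
      (1 - (q0 : ℂ) * Complex.exp (-Complex.I * (ξ j : ℂ))) *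
        (Complex.exp (Complex.I * ξ j) / (Complex.I * (2 * Complex.sin (ξ j)))) := by
    intro j; rw [← one_div_one_sub_exp_two_mul, mul_one_div]
  rw [cFun]
  simp only [h1, Complex.ofReal_zero, zero_mul, sub_zero, one_div_one_sub_exp_sub_mul,
    Finset.prod_mul_distrib, Finset.prod_div_distrib, Finset.prod_const, Fin.card_Ioi, pow_succ,
    Finset.card_univ, Fintype.card_fin, weylDenom]
  push_cast
  ring

/-- The two signs give a number minus its conjugate, that is, 2i times the imaginary part of
e^{i(l+1)x} - q₀e^{ilx}. -/
lemma sum_units_exp (q0 x : ℝ) (l : ℕ) :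
    ∑ ε : ℤˣ, (((ε : ℤ) : ℝ) : ℂ) *
        ((1 - (q0 : ℂ) * Complex.exp (-Complex.I * ((((ε : ℤ) : ℝ) * x : ℝ) : ℂ))) *
          Complex.exp (Complex.I * ((((ε : ℤ) : ℝ) * x : ℝ) : ℂ)) ^ (l + 1)) =
      Complex.I * (bernsteinSzego q0 l x : ℂ) := by
  have huniv : (Finset.univ : Finset ℤˣ) = {1, -1} := by decide
  rw [huniv, Finset.sum_pair (by decide)]
  have hs : ∀ k : ℕ, 2 * Complex.sin ((k : ℂ) * x) =
      (Complex.exp (-(Complex.I * x)) ^ k - Complex.exp (Complex.I * x) ^ k) * Complex.I := by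
    intro k
    rw [Complex.two_sin, ← Complex.exp_nat_mul, ← Complex.exp_nat_mul]
    congr 3 <;> ring
  have e3 : Complex.exp (-(Complex.I * x)) * Complex.exp (Complex.I * x) = 1 := by
    rw [← Complex.exp_add]; simp
  have h1 := hs (l + 1)
  have h2 := hs l
  simp only [bernsteinSzego]
  push_cast at h1 ⊢
  simp only [one_mul, neg_mul, mul_neg, neg_neg]
  have hI := Complex.I_sq
  generalize Complex.exp (-(Complex.I * x)) = b at *
  generalize Complex.exp (Complex.I * x) = a at *
  rw [pow_succ, pow_succ] at *
  linear_combination (-Complex.I) * h1 + q0 * Complex.I * h2 + (-(b ^ l * b - a ^ l * a) +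
    q0 * (b ^ l - a ^ l)) * hI + q0 * (b ^ l - a ^ l) * e3

/-- The determinant of the Bernstein-Szegő functions with labels `l` at the points `ξ`. -/
def bernsteinSzegoDet (q0 : ℝ) (l : Fin n → ℕ) (ξ : Fin n → ℝ) : ℝ :=
  (Matrix.of fun k j => bernsteinSzego q0 (l j) (ξ k)).det

/-- A Weyl character formula: the sum over signs factors over the coordinates into Bernstein-Szegő
functions, and the signed sum over permutations is the Leibniz expansion of their determinant. -/
lemma hallLittlewood_zero (q0 : ℝ) (μ : Fin n → ℕ) (ξ : Fin n → ℝ) :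
    hallLittlewood 0 q0 μ ξ = ((bernsteinSzegoDet q0 (shifted μ) ξ / weylDenom ξ : ℝ) : ℂ) := by
  have hterm : ∀ (σ : Equiv.Perm (Fin n)) (ε : Fin n → ℤˣ),
      cFun 0 q0 (signedPerm σ ε ξ) * planeWave μ (signedPerm σ ε ξ) =
      ((Equiv.Perm.sign σ : ℤ) : ℂ) * (∏ j, (((ε j : ℤ) : ℝ) : ℂ) *
        ((1 - (q0 : ℂ) * Complex.exp (-Complex.I * ((((ε j : ℤ) : ℝ) * ξ (σ j) : ℝ) : ℂ))) *
          Complex.exp (Complex.I * ((((ε j : ℤ) : ℝ) * ξ (σ j) : ℝ) : ℂ)) ^ (shifted μ j + 1))) /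
        (Complex.I ^ n * (weylDenom ξ : ℂ)) := by
    intro σ ε
    have hε : ∀ e : ℤˣ, (((e : ℤ) : ℝ) : ℂ)⁻¹ = (((e : ℤ) : ℝ) : ℂ) := by
      intro e; rcases Int.units_eq_one_or e with rfl | rfl <;> simp
    have hσ : (((Equiv.Perm.sign σ : ℤ) : ℂ))⁻¹ = ((Equiv.Perm.sign σ : ℤ) : ℂ) := by
      rcases Int.units_eq_one_or (Equiv.Perm.sign σ) with h | h <;> simp [h]
    have hpw : planeWave μ (signedPerm σ ε ξ) =
        ∏ j, Complex.exp (Complex.I * ((((ε j : ℤ) : ℝ) * ξ (σ j) : ℝ) : ℂ)) ^ (μ j) := by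
      rw [planeWave, Complex.exp_sum]
      refine Finset.prod_congr rfl fun j _ => ?_
      rw [← Complex.exp_nat_mul, signedPerm]
      congr 1
      ring
    have hε' : (∏ j, (((ε j : ℤ) : ℝ) : ℂ))⁻¹ = ∏ j, (((ε j : ℤ) : ℝ) : ℂ) := by
      rw [← Finset.prod_inv_distrib]
      exact Finset.prod_congr rfl fun j _ => hε (ε j)
    have hcast : (((Equiv.Perm.sign σ : ℤ) * (∏ j, ((ε j : ℤ) : ℝ)) * weylDenom ξ : ℝ) : ℂ) =
        ((Equiv.Perm.sign σ : ℤ) : ℂ) * (∏ j, (((ε j : ℤ) : ℝ) : ℂ)) * (weylDenom ξ : ℂ) := by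
      push_cast; rfl
    rw [cFun_zero, weylDenom_signedPerm, hpw, hcast, div_mul_eq_mul_div, ← Finset.prod_mul_distrib,
      Finset.prod_mul_distrib (f := fun j => (((ε j : ℤ) : ℝ) : ℂ)), div_eq_mul_inv, div_eq_mul_inv,
      mul_inv, mul_inv, mul_inv, mul_inv, hε', hσ]
    have hprod : ∀ j, (1 - (q0 : ℂ) * Complex.exp (-Complex.I *
        ((signedPerm σ ε ξ j : ℝ) : ℂ))) *
          Complex.exp (Complex.I * ((signedPerm σ ε ξ j : ℝ) : ℂ)) ^ (n - 1 - (j : ℕ) + 1) *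
          Complex.exp (Complex.I * ((((ε j : ℤ) : ℝ) * ξ (σ j) : ℝ) : ℂ)) ^ (μ j) =
        (1 - (q0 : ℂ) * Complex.exp (-Complex.I * ((((ε j : ℤ) : ℝ) * ξ (σ j) : ℝ) : ℂ))) *
          Complex.exp (Complex.I * ((((ε j : ℤ) : ℝ) * ξ (σ j) : ℝ) : ℂ)) ^ (shifted μ j + 1) := by
      intro j
      rw [signedPerm, mul_assoc, ← pow_add, shifted]
      congr 2
      ring
    simp only [hprod]
    ring
  have hsum : ∀ σ : Equiv.Perm (Fin n), ∑ ε : Fin n → ℤˣ,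
      cFun 0 q0 (signedPerm σ ε ξ) * planeWave μ (signedPerm σ ε ξ) =
      (((Equiv.Perm.sign σ : ℤ) : ℂ) *
        ∏ j, (bernsteinSzego q0 (shifted μ j) (ξ (σ j)) : ℂ)) / (weylDenom ξ : ℂ) := by
    intro σ
    simp only [hterm]
    rw [← Finset.sum_div, ← Finset.mul_sum,
      ← Fintype.prod_sum fun (j : Fin n) (e : ℤˣ) => (((e : ℤ) : ℝ) : ℂ) *
        ((1 - (q0 : ℂ) * Complex.exp (-Complex.I * ((((e : ℤ) : ℝ) * ξ (σ j) : ℝ) : ℂ))) *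
          Complex.exp (Complex.I * ((((e : ℤ) : ℝ) * ξ (σ j) : ℝ) : ℂ)) ^ (shifted μ j + 1))]
    simp only [sum_units_exp]
    rw [Finset.prod_mul_distrib, Finset.prod_const, Finset.card_univ, Fintype.card_fin,
      mul_left_comm, mul_div_mul_left _ _ (pow_ne_zero _ Complex.I_ne_zero)]
  rw [hallLittlewood, Finset.sum_congr rfl fun σ _ => hsum σ, ← Finset.sum_div,
    bernsteinSzegoDet, Matrix.det_apply']
  push_cast
  rfl

lemma norm_hallLittlewood_zero_sq (q0 : ℝ) (μ : Fin n → ℕ) (ξ : Fin n → ℝ) :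
    ‖hallLittlewood 0 q0 μ ξ‖ ^ 2 = bernsteinSzegoDet q0 (shifted μ) ξ ^ 2 / rho ξ := by
  rw [hallLittlewood_zero, Complex.norm_real, Real.norm_eq_abs, sq_abs, div_pow, weylDenom_sq]

lemma norm_one_sub_mul_exp_sq (q x : ℝ) :
    ‖1 - (q : ℂ) * Complex.exp (-Complex.I * (x : ℂ))‖ ^ 2 = quadDen q x := by
  have h : -Complex.I * (x : ℂ) = ((-x : ℝ) : ℂ) * Complex.I := by push_cast; ring
  rw [h, Complex.sq_norm, Complex.normSq_apply]
  simp only [Complex.sub_re, Complex.sub_im, Complex.re_ofReal_mul, Complex.im_ofReal_mul,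
    Complex.exp_ofReal_mul_I_re, Complex.exp_ofReal_mul_I_im, Complex.one_re, Complex.one_im,
    Real.cos_neg, Real.sin_neg, quadDen]
  linear_combination q ^ 2 * Real.sin_sq_add_cos_sq x

lemma norm_cFun_zero_sq (q0 : ℝ) (ξ : Fin n → ℝ) :
    ‖cFun 0 q0 ξ‖ ^ 2 = (∏ j, quadDen q0 (ξ j)) / rho ξ := by
  have h : ∀ x : ℝ, ‖Complex.exp (Complex.I * (x : ℂ))‖ = 1 := by
    intro x; rw [mul_comm]; exact Complex.norm_exp_ofReal_mul_I x
  rw [cFun_zero, norm_div, norm_mul, norm_pow, Complex.norm_I, one_pow, one_mul, Complex.norm_real,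
    Real.norm_eq_abs, div_pow, sq_abs, weylDenom_sq, norm_prod, ← Finset.prod_pow]
  simp only [norm_mul, norm_pow, h, one_pow, mul_one, norm_one_sub_mul_exp_sq]

lemma delta_zero (μ : Fin n → ℕ) : delta 0 μ = 1 := by
  refine Finset.prod_eq_one fun j _ => Finset.prod_eq_one fun k hk => ?_
  have h : j < k := Finset.mem_Ioi.1 hk
  rw [Fin.lt_def] at h
  split_ifs
  · rw [zero_pow (by omega), zero_pow (by omega)]; simp
  · rfl

lemma weylDenom_ne_zero {ξ : Fin n → ℝ} (hξ : ξ ∈ alcove n) : weylDenom ξ ≠ 0 := by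
  refine mul_ne_zero (Finset.prod_ne_zero_iff.2 fun j _ => mul_ne_zero two_ne_zero
    (Real.sin_pos_of_mem_Ioo (hξ.1 j)).ne')
    (Finset.prod_ne_zero_iff.2 fun j _ => Finset.prod_ne_zero_iff.2 fun k hk => ?_)
  have h := Real.strictAntiOn_cos (Set.Ioo_subset_Icc_self (hξ.1 k))
    (Set.Ioo_subset_Icc_self (hξ.1 j)) (hξ.2 (Finset.mem_Ioi.1 hk))
  exact (by linarith : 2 * Real.cos (ξ j) - 2 * Real.cos (ξ k) < 0).ne

lemma rho_ne_zero {ξ : Fin n → ℝ} (hξ : ξ ∈ alcove n) : rho ξ ≠ 0 := by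
  rw [← weylDenom_sq]
  exact pow_ne_zero 2 (weylDenom_ne_zero hξ)

/-! ### Strictly decreasing labels -/

lemma existsUnique_strictAnti_comp {α : Type*} [LinearOrder α] {f : Fin n → α}
    (hf : Function.Injective f) : ∃! σ : Equiv.Perm (Fin n), StrictAnti (f ∘ σ) := by
  refine ⟨Tuple.sort (OrderDual.toDual ∘ f), ?_, fun τ hτ => ?_⟩
  · have h : Antitone (f ∘ Tuple.sort (OrderDual.toDual ∘ f)) :=
      Tuple.monotone_sort (OrderDual.toDual ∘ f)
    exact h.strictAnti_of_injective (hf.comp (Equiv.injective _))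
  · have h : (OrderDual.toDual ∘ f) ∘ τ =
        (OrderDual.toDual ∘ f) ∘ Tuple.sort (OrderDual.toDual ∘ f) :=
      Tuple.unique_monotone hτ.antitone (Tuple.monotone_sort (OrderDual.toDual ∘ f))
    ext j
    rw [hf (congrFun h j)]

open Classical in
/-- A symmetric function vanishing at non-injective tuples is recovered from its restriction to
strictly decreasing tuples. -/
lemma sum_perm_ite_strictAnti {α M : Type*} [LinearOrder α] [AddCommMonoid M]
    {F : (Fin n → α) → M} (hsymm : ∀ (σ : Equiv.Perm (Fin n)) f, F (f ∘ σ) = F f)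
    (hzero : ∀ f, ¬Function.Injective f → F f = 0) (f : Fin n → α) :
    ∑ σ : Equiv.Perm (Fin n), (if StrictAnti (f ∘ σ) then F (f ∘ σ) else 0) = F f := by
  by_cases hf : Function.Injective f
  · obtain ⟨τ, hτ, hτ'⟩ := existsUnique_strictAnti_comp hf
    rw [Finset.sum_eq_single τ, if_pos hτ, hsymm]
    · exact fun σ _ hσ => if_neg fun h => hσ (hτ' σ h)
    · simp
  · simp [hsymm, hzero f hf]

open Classical in
-- Non-injective tuples contribute nothing, and every injective one has exactly one strictly
-- decreasing rearrangement. Both Cauchy-Binet and the cubature sum use this.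
lemma sum_piFinset_eq_factorial {M : Type*} [AddCommMonoid M] (s : Finset ℕ)
    {F : (Fin n → ℕ) → M} (hsymm : ∀ (σ : Equiv.Perm (Fin n)) f, F (f ∘ σ) = F f)
    (hzero : ∀ f, ¬Function.Injective f → F f = 0) :
    ∑ l ∈ Fintype.piFinset (fun _ : Fin n => s), F l =
      n.factorial • ∑ l ∈ Fintype.piFinset (fun _ : Fin n => s) with StrictAnti l, F l := by
  rw [← Finset.sum_congr rfl fun l _ => sum_perm_ite_strictAnti hsymm hzero l, Finset.sum_comm]
  have h : ∀ σ : Equiv.Perm (Fin n), ∑ l ∈ Fintype.piFinset (fun _ : Fin n => s),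
      (if StrictAnti (l ∘ σ) then F (l ∘ σ) else 0) =
      ∑ l ∈ Fintype.piFinset (fun _ : Fin n => s) with StrictAnti l, F l := by
    intro σ
    rw [Finset.sum_filter]
    refine Finset.sum_bij' (fun l _ => l ∘ σ) (fun l _ => l ∘ σ.symm) ?_ ?_ ?_ ?_ ?_
    · intro l hl
      rw [Fintype.mem_piFinset] at hl ⊢
      exact fun j => hl (σ j)
    · intro l hl
      rw [Fintype.mem_piFinset] at hl ⊢
      exact fun j => hl (σ.symm j)
    · intro l _; funext j; simp
    · intro l _; funext j; simp
    · intro l _; rfl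
  rw [Finset.sum_congr rfl fun σ _ => h σ, Finset.sum_const, Finset.card_univ,
    Fintype.card_perm, Fintype.card_fin]

lemma StrictAnti.add_sub_le {l : Fin n → ℕ} (hl : StrictAnti l) {j k : Fin n} (hjk : j ≤ k) :
    l k + ((k : ℕ) - j) ≤ l j := by
  obtain ⟨k, hk⟩ := k
  induction k with
  | zero =>
    have : j = ⟨0, hk⟩ := le_antisymm hjk (Fin.mk_le_of_le_val (Nat.zero_le _))
    simp [this]
  | succ k ih =>
    rcases hjk.lt_or_eq with h | h
    · have h1 : (j : ℕ) < k + 1 := Fin.lt_def.1 h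
      have h2 := ih (by omega) (Fin.le_def.2 (Nat.lt_succ_iff.1 h1) : j ≤ ⟨k, by omega⟩)
      have h3 : l ⟨k + 1, hk⟩ < l ⟨k, by omega⟩ := hl (Fin.mk_lt_mk.2 (Nat.lt_succ_self k))
      simp only at h2 ⊢
      omega
    · simp [h]

open Classical in
-- Adding the staircase n - 1 - j is a bijection from decreasing labels in [0, m] to strictly
-- decreasing ones in [0, m + n). The inverse uses truncated subtraction, which is harmless because
-- a strictly decreasing label satisfies l_j ≥ n - 1 - j.
lemma sum_weights_shifted {M : Type*} [AddCommMonoid M] (m n : ℕ) (F : (Fin n → ℕ) → M) :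
    ∑ μ ∈ weights m n, F (shifted μ) =
      ∑ l ∈ Fintype.piFinset (fun _ : Fin n => Finset.range (m + n)) with StrictAnti l, F l := by
  have hmem : ∀ l : Fin n → ℕ, l ∈ (Fintype.piFinset (fun _ : Fin n => Finset.range (m + n))).filter
      StrictAnti ↔ (∀ j, l j < m + n) ∧ StrictAnti l := by
    intro l; simp
  have hge : ∀ l : Fin n → ℕ, StrictAnti l → ∀ j : Fin n, n - 1 - (j : ℕ) ≤ l j := by
    intro l hl j
    have hj := j.2
    have := StrictAnti.add_sub_le hl
      (show j ≤ ⟨n - 1, by omega⟩ from Fin.le_def.2 (by simp only; omega))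
    simp only at this
    omega
  refine Finset.sum_bij' (fun μ _ => shifted μ) (fun l _ j => l j - (n - 1 - (j : ℕ))) ?_ ?_ ?_ ?_ ?_
  · intro μ hμ
    exact (hmem _).2 ⟨shifted_lt hμ, strictAnti_shifted hμ⟩
  · intro l hl
    obtain ⟨hl1, hl2⟩ := (hmem _).1 hl
    refine mem_weights.2 ⟨fun j => ?_, fun j k hjk => ?_⟩
    · have hj := j.2
      have h1 := StrictAnti.add_sub_le hl2
        (show (⟨0, by omega⟩ : Fin n) ≤ j from Fin.le_def.2 (by simp))
      have h2 := hl1 ⟨0, by omega⟩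
      simp only at h1
      omega
    · have h1 := StrictAnti.add_sub_le hl2 hjk
      have h2 : (j : ℕ) ≤ k := hjk
      have h3 := k.2
      simp only
      omega
  · intro μ _
    funext j
    simp [shifted]
  · intro l hl
    funext j
    have := hge l ((hmem _).1 hl).2 j
    simp only [shifted]
    omega
  · intro μ _; rfl

/-! ### Christoffel weights -/

lemma bernsteinSzegoDet_comp_perm (q0 : ℝ) (l : Fin n → ℕ) (ξ : Fin n → ℝ)
    (σ : Equiv.Perm (Fin n)) :
    bernsteinSzegoDet q0 (l ∘ σ) ξ = (Equiv.Perm.sign σ : ℤ) * bernsteinSzegoDet q0 l ξ :=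
  Matrix.det_permute' σ (Matrix.of fun k j => bernsteinSzego q0 (l j) (ξ k))

lemma bernsteinSzegoDet_of_not_injective (q0 : ℝ) {l : Fin n → ℕ} (ξ : Fin n → ℝ)
    (hl : ¬Function.Injective l) : bernsteinSzegoDet q0 l ξ = 0 := by
  obtain ⟨i, j, hij, hne⟩ := Function.not_injective_iff.1 hl
  exact Matrix.det_zero_of_column_eq hne fun k => by simp [hij]

/-- The Cauchy-Binet formula for orthogonal rows. -/
lemma sum_bernsteinSzegoDet_sq (q0 : ℝ) (N : ℕ) (ξ K : Fin n → ℝ)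
    (hK : ∀ j k, ∑ a ∈ Finset.range N, bernsteinSzego q0 a (ξ j) * bernsteinSzego q0 a (ξ k) =
      if j = k then K j else 0) :
    ∑ l ∈ Fintype.piFinset (fun _ : Fin n => Finset.range N), bernsteinSzegoDet q0 l ξ ^ 2 =
      n.factorial * ∏ j, K j := by
  have h1 : ∀ l : Fin n → ℕ, bernsteinSzegoDet q0 l ξ ^ 2 =
      ∑ σ : Equiv.Perm (Fin n), ∑ τ : Equiv.Perm (Fin n),
        ((Equiv.Perm.sign σ : ℤ) : ℝ) * ((Equiv.Perm.sign τ : ℤ) : ℝ) *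
        ∏ j, bernsteinSzego q0 (l j) (ξ (σ j)) * bernsteinSzego q0 (l j) (ξ (τ j)) := by
    intro l
    rw [bernsteinSzegoDet, Matrix.det_apply', sq, Finset.sum_mul_sum]
    refine Finset.sum_congr rfl fun σ _ => Finset.sum_congr rfl fun τ _ => ?_
    rw [Finset.prod_mul_distrib]
    simp only [Matrix.of_apply]
    ring
  have h2 : ∀ σ τ : Equiv.Perm (Fin n),
      ∑ l ∈ Fintype.piFinset (fun _ : Fin n => Finset.range N),
        ∏ j, bernsteinSzego q0 (l j) (ξ (σ j)) * bernsteinSzego q0 (l j) (ξ (τ j)) =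
      if σ = τ then ∏ j, K j else 0 := by
    intro σ τ
    -- For fixed σ and τ the sum over labels factors into kernels at (ξ_{σ j}, ξ_{τ j}), so only σ =
    -- τ survives.
    rw [← Finset.prod_univ_sum (fun _ => Finset.range N) fun j a =>
      bernsteinSzego q0 a (ξ (σ j)) * bernsteinSzego q0 a (ξ (τ j))]
    simp only [hK]
    split_ifs with h
    · subst h
      simp only [if_true]
      exact Equiv.prod_comp σ K
    · obtain ⟨j, hj⟩ := not_forall.1 fun h' => h (Equiv.ext h')
      exact Finset.prod_eq_zero (Finset.mem_univ j) (if_neg hj)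
  simp only [h1]
  rw [Finset.sum_comm]
  have h3 : ∀ σ : Equiv.Perm (Fin n),
      ∑ l ∈ Fintype.piFinset (fun _ : Fin n => Finset.range N), ∑ τ : Equiv.Perm (Fin n),
        ((Equiv.Perm.sign σ : ℤ) : ℝ) * ((Equiv.Perm.sign τ : ℤ) : ℝ) *
        ∏ j, bernsteinSzego q0 (l j) (ξ (σ j)) * bernsteinSzego q0 (l j) (ξ (τ j)) =
      ∏ j, K j := by
    intro σ
    rw [Finset.sum_comm]
    simp only [← Finset.mul_sum, h2]
    rw [Finset.sum_eq_single σ]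
    · rcases Int.units_eq_one_or (Equiv.Perm.sign σ) with h | h <;> simp [h]
    · intro τ _ hτ
      simp [hτ.symm]
    · simp
  rw [Finset.sum_congr rfl fun σ _ => h3 σ, Finset.sum_const, Finset.card_univ,
    Fintype.card_perm, Fintype.card_fin, nsmul_eq_mul]

lemma sum_weights_bernsteinSzegoDet_sq (q0 : ℝ) (m : ℕ) (ξ K : Fin n → ℝ)
    (hK : ∀ j k, ∑ a ∈ Finset.range (m + n),
      bernsteinSzego q0 a (ξ j) * bernsteinSzego q0 a (ξ k) = if j = k then K j else 0) :
    ∑ μ ∈ weights m n, bernsteinSzegoDet q0 (shifted μ) ξ ^ 2 = ∏ j, K j := by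
  classical
  have h := sum_bernsteinSzegoDet_sq q0 (m + n) ξ K hK
  rw [sum_piFinset_eq_factorial (Finset.range (m + n)) (F := fun l => bernsteinSzegoDet q0 l ξ ^ 2),
    nsmul_eq_mul] at h
  · rw [sum_weights_shifted m n fun l => bernsteinSzegoDet q0 l ξ ^ 2]
    exact mul_left_cancel₀ (Nat.cast_ne_zero.2 (Nat.factorial_ne_zero n)) h
  · intro σ f
    simp only [bernsteinSzegoDet_comp_perm, mul_pow]
    rcases Int.units_eq_one_or (Equiv.Perm.sign σ) with h | h <;> simp [h]
  · intro f hf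
    simp [bernsteinSzegoDet_of_not_injective q0 ξ hf]

/-- Both |C|² and the sum of |P_μ|² carry 1/ρ, which is finite because the node lies in the alcove.
What remains are products over the coordinates. -/
lemma christoffel_eq {m : ℕ} (hq0 : q0 ∈ Set.Ioo (-1 : ℝ) 1) (hq1 : q1 ∈ Set.Ioo (-1 : ℝ) 1)
    {lam : Fin n → ℕ} (hlam : lam ∈ weights m n) :
    christoffel m 0 q0 q1 lam =
      (∏ j, quadDen q0 (node m 0 q0 q1 lam j)) /
        ∏ j, kernelDiag (m + n) q0 (node m 0 q0 q1 lam j) := by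
  have hl := shifted_lt hlam
  have hanti := strictAnti_shifted hlam
  have hrho := rho_ne_zero (rootVec_mem_alcove hq0 hq1 hl hanti)
  rw [christoffel, christoffelHat, node_eq hq0 hq1 hlam, norm_cFun_zero_sq]
  simp only [norm_hallLittlewood_zero_sq, delta_zero, mul_one]
  rw [← Finset.sum_div, sum_weights_bernsteinSzegoDet_sq q0 m _
    (fun j => kernelDiag (m + n) q0 (rootVec (m + n) q0 q1 (shifted lam) j)), inv_div,
    div_mul_div_cancel₀ hrho]
  intro j k
  rw [rootVec, rootVec, sum_bernsteinSzego_root hq0 hq1 (hl j) (hl k)]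
  simp only [hanti.injective.eq_iff]

lemma christoffel_eq_prod {m : ℕ} (hq0 : q0 ∈ Set.Ioo (-1 : ℝ) 1)
    (hq1 : q1 ∈ Set.Ioo (-1 : ℝ) 1) {lam : Fin n → ℕ} (hlam : lam ∈ weights m n) :
    christoffel m 0 q0 q1 lam = ∏ j, (2 * ((m + n : ℕ) : ℝ) +
      u q0 (root (m + n) q0 q1 (shifted lam j)) + u q1 (root (m + n) q0 q1 (shifted lam j)))⁻¹ := by
  rw [christoffel_eq hq0 hq1 hlam, node_eq hq0 hq1 hlam, ← Finset.prod_div_distrib]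
  refine Finset.prod_congr rfl fun j _ => ?_
  rw [rootVec, kernelDiag_root hq0 hq1 (shifted_lt hlam j), div_mul_cancel_left₀
    (quadDen_pos hq0 _).ne']

lemma christoffel1_eq {N l : ℕ} (hq0 : q0 ∈ Set.Ioo (-1 : ℝ) 1) (hq1 : q1 ∈ Set.Ioo (-1 : ℝ) 1)
    (hl : l < N) : christoffel1 N q0 q1 l =
      (2 * (N : ℝ) + u q0 (root N q0 q1 l) + u q1 (root N q0 q1 l))⁻¹ := by
  rw [christoffel1, christoffel_eq_prod hq0 hq1 (const_mem_weights_one hl)]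
  simp only [shifted, Nat.sub_add_cancel (show 1 ≤ N by omega), Finset.univ_unique,
    Finset.prod_singleton]
  simp

/-! ### Polynomials in the cosines -/

/-- `f` is a polynomial in the cosines of the coordinates, of degree at most `d i` in the `i`-th. -/
def IsCosPoly (d : Fin n → ℕ) (f : (Fin n → ℝ) → ℂ) : Prop :=
  ∃ P : MvPolynomial (Fin n) ℂ, (∀ i, P.degreeOf i ≤ d i) ∧
    ∀ ξ, f ξ = MvPolynomial.eval (fun j => (Real.cos (ξ j) : ℂ)) P

namespace IsCosPoly

variable {d e : Fin n → ℕ} {f g : (Fin n → ℝ) → ℂ}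

lemma mono (hf : IsCosPoly d f) (h : d ≤ e) : IsCosPoly e f := by
  obtain ⟨P, hP, hPf⟩ := hf
  exact ⟨P, fun i => (hP i).trans (h i), hPf⟩

lemma const (d : Fin n → ℕ) (c : ℂ) : IsCosPoly d fun _ => c :=
  ⟨MvPolynomial.C c, fun i => by simp, fun ξ => by simp⟩

lemma add (hf : IsCosPoly d f) (hg : IsCosPoly d g) : IsCosPoly d fun ξ => f ξ + g ξ := by
  obtain ⟨P, hP, hPf⟩ := hf
  obtain ⟨Q, hQ, hQg⟩ := hg
  exact ⟨P + Q, fun i => (MvPolynomial.degreeOf_add_le i P Q).trans (max_le (hP i) (hQ i)),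
    fun ξ => by simp only [hPf, hQg, map_add]⟩

lemma mul (hf : IsCosPoly d f) (hg : IsCosPoly e g) :
    IsCosPoly (d + e) fun ξ => f ξ * g ξ := by
  obtain ⟨P, hP, hPf⟩ := hf
  obtain ⟨Q, hQ, hQg⟩ := hg
  exact ⟨P * Q, fun i => (MvPolynomial.degreeOf_mul_le i P Q).trans (add_le_add (hP i) (hQ i)),
    fun ξ => by simp only [hPf, hQg, map_mul]⟩

lemma const_mul (c : ℂ) (hf : IsCosPoly d f) : IsCosPoly d fun ξ => c * f ξ := by
  simpa using (const 0 c).mul hf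

lemma sub (hf : IsCosPoly d f) (hg : IsCosPoly d g) : IsCosPoly d fun ξ => f ξ - g ξ := by
  convert! hf.add (hg.const_mul (-1)) using 2
  ring

lemma sum {ι : Type*} (s : Finset ι) {F : ι → (Fin n → ℝ) → ℂ}
    (h : ∀ a ∈ s, IsCosPoly d (F a)) : IsCosPoly d fun ξ => ∑ a ∈ s, F a ξ := by
  classical
  induction s using Finset.induction_on with
  | empty => simpa using const d 0
  | insert a s ha ih =>
    simp only [Finset.sum_insert ha]
    exact (h a (Finset.mem_insert_self a s)).add (ih fun b hb => h b (Finset.mem_insert_of_mem hb))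

lemma prod {ι : Type*} (s : Finset ι) {D : ι → Fin n → ℕ} {F : ι → (Fin n → ℝ) → ℂ}
    (h : ∀ a ∈ s, IsCosPoly (D a) (F a)) : IsCosPoly (∑ a ∈ s, D a) fun ξ => ∏ a ∈ s, F a ξ := by
  classical
  induction s using Finset.induction_on with
  | empty => simpa using const 0 1
  | insert a s ha ih =>
    simp only [Finset.prod_insert ha, Finset.sum_insert ha]
    exact (h a (Finset.mem_insert_self a s)).mul (ih fun b hb => h b (Finset.mem_insert_of_mem hb))

lemma cos (i : Fin n) : IsCosPoly (Pi.single i 1) fun ξ => (Real.cos (ξ i) : ℂ) := by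
  refine ⟨MvPolynomial.X i, fun j => ?_, fun ξ => by simp⟩
  rw [MvPolynomial.degreeOf_X]
  by_cases h : i = j
  · subst h; simp
  · simp [Ne.symm h]

/-- Chebyshev's recurrence for cos kx. -/
lemma cos_nat_mul (i : Fin n) (k : ℕ) :
    IsCosPoly (Pi.single i k) fun ξ => (Real.cos ((k : ℝ) * ξ i) : ℂ) := by
  induction k using Nat.twoStepInduction with
  | zero => simpa using const 0 1
  | one => simpa using cos i
  | more k h0 h1 =>
    have h := ((cos i).mul h1).const_mul 2
    rw [← Pi.single_add, show 1 + (k + 1) = k + 2 by ring] at h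
    convert! h.sub (h0.mono (Pi.single_mono (i := i) (by omega : k ≤ k + 2))) using 2 with ξ
    have h2 : ((k + 2 : ℕ) : ℝ) * ξ i = ((k : ℝ) * ξ i + ξ i) + ξ i := by push_cast; ring
    have h3 : ((k + 1 : ℕ) : ℝ) * ξ i = (k : ℝ) * ξ i + ξ i := by push_cast; ring
    rw [h2, h3]
    have h4 := Real.cos_add ((k : ℝ) * ξ i + ξ i) (ξ i)
    rw [Real.sin_add] at h4
    have h5 := Real.cos_add ((k : ℝ) * ξ i) (ξ i)
    have h6 := Real.sin_sq_add_cos_sq (ξ i)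
    have : Real.cos ((k : ℝ) * ξ i + ξ i + ξ i) =
        2 * (Real.cos (ξ i) * Real.cos ((k : ℝ) * ξ i + ξ i)) - Real.cos ((k : ℝ) * ξ i) := by
      linear_combination h4 - Real.cos (ξ i) * h5 - Real.cos ((k : ℝ) * ξ i) * h6
    rw [this]
    push_cast
    rfl

lemma continuous (hf : IsCosPoly d f) : Continuous f := by
  obtain ⟨P, -, hPf⟩ := hf
  rw [funext hPf]
  exact (MvPolynomial.continuous_eval P).comp (by fun_prop)

end IsCosPoly

lemma sum_planeWave_signedPerm (μ : Fin n → ℕ) (σ : Equiv.Perm (Fin n)) (ξ : Fin n → ℝ) :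
    ∑ ε : Fin n → ℤˣ, planeWave μ (signedPerm σ ε ξ) =
      ∏ j, 2 * (Real.cos ((μ j : ℝ) * ξ (σ j)) : ℂ) := by
  have h : ∀ ε : Fin n → ℤˣ, planeWave μ (signedPerm σ ε ξ) =
      ∏ j, Complex.exp (Complex.I * ((((ε j : ℤ) : ℝ) * ξ (σ j) : ℝ) : ℂ) * (μ j : ℂ)) := by
    intro ε
    rw [planeWave, Complex.exp_sum]
    rfl
  simp only [h]
  rw [← Fintype.prod_sum fun (j : Fin n) (e : ℤˣ) =>
    Complex.exp (Complex.I * ((((e : ℤ) : ℝ) * ξ (σ j) : ℝ) : ℂ) * (μ j : ℂ))]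
  refine Finset.prod_congr rfl fun j _ => ?_
  have huniv : (Finset.univ : Finset ℤˣ) = {1, -1} := by decide
  rw [huniv, Finset.sum_pair (by decide), Complex.ofReal_cos, Complex.two_cos]
  push_cast
  congr 2 <;> ring

lemma isCosPoly_symMonomial {m : ℕ} {μ : Fin n → ℕ} (hμ : ∀ j, μ j ≤ m) :
    IsCosPoly (fun _ => m) (symMonomial μ) := by
  unfold symMonomial
  simp only [sum_planeWave_signedPerm]
  refine (IsCosPoly.sum _ fun σ _ => ?_).const_mul _
  refine (IsCosPoly.prod Finset.univ (D := fun j => Pi.single (σ j) (μ j)) fun j _ =>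
    (IsCosPoly.cos_nat_mul (σ j) (μ j)).const_mul 2).mono fun i => ?_
  -- In the term of σ, the variable i occurs only in the factor with index σ⁻¹ i.
  rw [Finset.sum_apply, Finset.sum_eq_single (σ.symm i)]
  · simpa using hμ _
  · intro j _ hj
    exact Pi.single_eq_of_ne (fun h => hj (by rw [h, Equiv.symm_apply_apply])) _
  · simp

lemma symMonomial_comp_perm (μ : Fin n → ℕ) (τ : Equiv.Perm (Fin n)) (ξ : Fin n → ℝ) :
    symMonomial μ (ξ ∘ τ) = symMonomial μ ξ := by
  rw [symMonomial, symMonomial, ← Equiv.sum_comp (Equiv.mulLeft τ) fun σ =>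
    ∑ ε : Fin n → ℤˣ, planeWave μ (signedPerm σ ε ξ)]
  rfl

lemma isCosPoly_of_mem_polySpace {m : ℕ} {f : (Fin n → ℝ) → ℂ} (hf : f ∈ polySpace m n) :
    IsCosPoly (fun _ => m) f := by
  induction hf using Submodule.span_induction with
  | mem f hf =>
    obtain ⟨μ, hμ, rfl⟩ := hf
    exact isCosPoly_symMonomial (mem_weights.1 hμ).1
  | zero => exact IsCosPoly.const _ 0
  | add f g _ _ hf hg => exact hf.add hg
  | smul a f _ hf => exact hf.const_mul a

lemma polySpace_comp_perm {m : ℕ} {f : (Fin n → ℝ) → ℂ} (hf : f ∈ polySpace m n)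
    (τ : Equiv.Perm (Fin n)) (ξ : Fin n → ℝ) : f (ξ ∘ τ) = f ξ := by
  induction hf using Submodule.span_induction with
  | mem f hf =>
    obtain ⟨μ, -, rfl⟩ := hf
    exact symMonomial_comp_perm μ τ ξ
  | zero => rfl
  | add f g _ _ hf hg => simp only [Pi.add_apply, hf, hg]
  | smul a f _ hf => simp only [Pi.smul_apply, hf]

/-! ### The squared Vandermonde product -/

/-- The squared Vandermonde product in the variables `2 cos ξ_j`. -/
def cosVandermondeSq (ξ : Fin n → ℝ) : ℝ :=
  (∏ j, ∏ k ∈ Finset.Ioi j, (2 * Real.cos (ξ j) - 2 * Real.cos (ξ k))) ^ 2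

lemma rho_eq (ξ : Fin n → ℝ) :
    rho ξ = (∏ j, 4 * Real.sin (ξ j) ^ 2) * cosVandermondeSq ξ := by
  rw [← weylDenom_sq, weylDenom, cosVandermondeSq, mul_pow, ← Finset.prod_pow]
  congr 1
  exact Finset.prod_congr rfl fun j _ => by ring

lemma cosVandermondeSq_comp_perm (σ : Equiv.Perm (Fin n)) (ξ : Fin n → ℝ) :
    cosVandermondeSq (ξ ∘ σ) = cosVandermondeSq ξ := by
  simp only [cosVandermondeSq, Function.comp_apply]
  rw [prod_prod_Ioi_sub_perm (fun j => 2 * Real.cos (ξ j)) σ, mul_pow]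
  rcases Int.units_eq_one_or (Equiv.Perm.sign σ) with h | h <;> simp [h]

lemma cosVandermondeSq_of_not_injective {ξ : Fin n → ℝ} (hξ : ¬Function.Injective ξ) :
    cosVandermondeSq ξ = 0 := by
  obtain ⟨i, j, hij, hne⟩ := Function.not_injective_iff.1 hξ
  rw [cosVandermondeSq, sq_eq_zero_iff]
  rcases lt_or_gt_of_ne hne with h | h
  · exact Finset.prod_eq_zero (Finset.mem_univ i)
      (Finset.prod_eq_zero (Finset.mem_Ioi.2 h) (by rw [hij, sub_self]))
  · exact Finset.prod_eq_zero (Finset.mem_univ j)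
      (Finset.prod_eq_zero (Finset.mem_Ioi.2 h) (by rw [hij, sub_self]))

lemma isCosPoly_cosVandermondeSq :
    IsCosPoly (fun _ : Fin n => 2 * (n - 1)) fun ξ => (cosVandermondeSq ξ : ℂ) := by
  have h1 : ∀ j k : Fin n, IsCosPoly (Pi.single j 1 + Pi.single k 1)
      fun ξ => ((2 * Real.cos (ξ j) - 2 * Real.cos (ξ k) : ℝ) : ℂ) := by
    intro j k
    convert! (((IsCosPoly.cos j).mono le_self_add).const_mul 2).sub
      (((IsCosPoly.cos k).mono le_add_self).const_mul 2) using 2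
    push_cast
    rfl
  have h2 := IsCosPoly.prod Finset.univ fun (j : Fin n) _ =>
    IsCosPoly.prod (Finset.Ioi j) fun k _ => h1 j k
  have h3 := h2.mul h2
  convert! h3.mono (e := fun _ : Fin n => 2 * (n - 1)) fun i => ?_ using 2 with ξ
  · rw [cosVandermondeSq, sq]
    push_cast
    rfl
  · have h4 := sum_sum_Ioi_add fun j : Fin n => (Pi.single j (1 : ℝ) : Fin n → ℝ) i
    have h5 : ∑ j : Fin n, (Pi.single j (1 : ℝ) : Fin n → ℝ) i = 1 := by
      simp [Pi.single_apply]
    have h6 : (((∑ j : Fin n, ∑ k ∈ Finset.Ioi j,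
        (Pi.single j 1 + Pi.single k 1 : Fin n → ℕ)) i : ℕ) : ℝ) = (n : ℝ) - 1 := by
      refine Eq.trans ?_ (h4.trans (by rw [h5, mul_one]))
      simp only [Finset.sum_apply, Pi.add_apply, Nat.cast_sum, Nat.cast_add, Pi.single_apply,
        Nat.cast_ite, Nat.cast_one, Nat.cast_zero]
    have h7 : 1 ≤ n := i.pos
    have h8 : (∑ j : Fin n, ∑ k ∈ Finset.Ioi j,
        (Pi.single j 1 + Pi.single k 1 : Fin n → ℕ)) i = n - 1 := by
      have : (((n - 1 : ℕ)) : ℝ) = (n : ℝ) - 1 := by rw [Nat.cast_sub h7, Nat.cast_one]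
      exact_mod_cast h6.trans this.symm
    rw [Pi.add_apply, h8, two_mul]

/-! ### Product quadrature on the cube -/

/-- On each monomial both sides factor over the coordinates, so only the degree in each separate
cosine matters, not the total degree. -/
lemma quadrature_cube {N D : ℕ} (hq0 : q0 ∈ Set.Ioo (-1 : ℝ) 1) (hq1 : q1 ∈ Set.Ioo (-1 : ℝ) 1)
    (hD : D + 2 ≤ 2 * N) {g : (Fin n → ℝ) → ℂ} (hg : IsCosPoly (fun _ => D) g) :
    ∫ ξ in Set.univ.pi fun _ : Fin n => Set.Ioo 0 Real.pi,
      g ξ * ((∏ j, 4 * Real.sin (ξ j) ^ 2 / quadDen q0 (ξ j) : ℝ) : ℂ) =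
    (2 * (Real.pi : ℂ)) ^ n * ∑ l ∈ Fintype.piFinset (fun _ : Fin n => Finset.range N),
      g (rootVec N q0 q1 l) * ((∏ j, 4 * Real.sin (rootVec N q0 q1 l j) ^ 2 /
        kernelDiag N q0 (rootVec N q0 q1 l j) : ℝ) : ℂ) := by
  obtain ⟨P, hP, hPg⟩ := hg
  let F : (Fin n →₀ ℕ) → Fin n → ℝ → ℂ := fun s j x =>
    ((Real.cos x ^ s j * (4 * Real.sin x ^ 2) / quadDen q0 x : ℝ) : ℂ)
  let G : (Fin n →₀ ℕ) → Fin n → ℕ → ℂ := fun s j a =>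
    ((Real.cos (root N q0 q1 a) ^ s j * (4 * Real.sin (root N q0 q1 a) ^ 2) /
      kernelDiag N q0 (root N q0 q1 a) : ℝ) : ℂ)
  have hFc : ∀ s j, Continuous (F s j) := fun s j => Complex.continuous_ofReal.comp
    (Continuous.div (by fun_prop) (continuous_quadDen q0) fun x => (quadDen_pos hq0 x).ne')
  have hF : ∀ ξ, g ξ * ((∏ j, 4 * Real.sin (ξ j) ^ 2 / quadDen q0 (ξ j) : ℝ) : ℂ) =
      ∑ s ∈ P.support, P.coeff s * ∏ j, F s j (ξ j) := by
    intro ξ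
    rw [hPg, MvPolynomial.eval_eq', Finset.sum_mul]
    refine Finset.sum_congr rfl fun s _ => ?_
    rw [Complex.ofReal_prod, mul_assoc, ← Finset.prod_mul_distrib]
    congr 1
    refine Finset.prod_congr rfl fun j _ => ?_
    simp only [F]
    push_cast
    ring
  have hG : ∀ l : Fin n → ℕ, g (rootVec N q0 q1 l) *
      ((∏ j, 4 * Real.sin (rootVec N q0 q1 l j) ^ 2 /
        kernelDiag N q0 (rootVec N q0 q1 l j) : ℝ) : ℂ) =
      ∑ s ∈ P.support, P.coeff s * ∏ j, G s j (l j) := by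
    intro l
    rw [hPg, MvPolynomial.eval_eq', Finset.sum_mul]
    refine Finset.sum_congr rfl fun s _ => ?_
    rw [Complex.ofReal_prod, mul_assoc, ← Finset.prod_mul_distrib]
    congr 1
    refine Finset.prod_congr rfl fun j _ => ?_
    simp only [G, rootVec]
    push_cast
    ring
  have hint : ∀ s, IntegrableOn (fun ξ : Fin n → ℝ => P.coeff s * ∏ j, F s j (ξ j))
      (Set.univ.pi fun _ : Fin n => Set.Ioo 0 Real.pi) volume := by
    intro s
    refine IntegrableOn.mono_set (t := Set.univ.pi fun _ : Fin n => Set.Icc 0 Real.pi) ?_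
      (Set.pi_mono fun _ _ => Set.Ioo_subset_Icc_self)
    refine Continuous.continuousOn ?_ |>.integrableOn_compact (isCompact_univ_pi fun _ => isCompact_Icc)
    exact continuous_const.mul (continuous_finsetProd _ fun j _ =>
      (hFc s j).comp (continuous_apply j))
  simp only [hF, hG]
  rw [integral_finsetSum _ fun s _ => hint s, Finset.sum_comm, Finset.mul_sum]
  refine Finset.sum_congr rfl fun s hs => ?_
  rw [integral_const_mul, ← Finset.mul_sum, mul_left_comm,
    ← Finset.prod_univ_sum (fun _ => Finset.range N) (G s), volume_pi, Measure.restrict_pi_pi,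
    integral_fintype_prod_eq_prod]
  congr 1
  have hconst : (2 * (Real.pi : ℂ)) ^ n = ∏ _j : Fin n, 2 * (Real.pi : ℂ) := by simp
  rw [hconst, ← Finset.prod_mul_distrib]
  refine Finset.prod_congr rfl fun j _ => ?_
  have hsj : s j + 2 ≤ 2 * N := by
    have : s j ≤ D := (MvPolynomial.monomial_le_degreeOf j hs).trans (hP j)
    omega
  have h := congrArg Complex.ofReal (quadrature_one N hq0 hq1 hsj)
  rw [intervalIntegral.integral_of_le Real.pi_pos.le, integral_Ioc_eq_integral_Ioo,
    ← integral_complex_ofReal] at h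
  simp only [F, G]
  refine h.trans ?_
  push_cast
  rfl

/-! ### Symmetrization of integrals -/

lemma measurableSet_alcove (n : ℕ) : MeasurableSet (alcove n) := by
  have : alcove n = (⋂ j : Fin n, {ξ | 0 < ξ j} ∩ {ξ | ξ j < Real.pi}) ∩
      ⋂ j : Fin n, ⋂ k : Fin n, ⋂ _ : j < k, {ξ | ξ k < ξ j} := by
    ext ξ
    simp [alcove, StrictAnti]
  rw [this]
  refine (MeasurableSet.iInter fun j => ?_).inter
    (MeasurableSet.iInter fun j => MeasurableSet.iInter fun k => MeasurableSet.iInter fun _ => ?_)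
  · exact (measurableSet_lt measurable_const (measurable_pi_apply j)).inter
      (measurableSet_lt (measurable_pi_apply j) measurable_const)
  · exact measurableSet_lt (measurable_pi_apply k) (measurable_pi_apply j)

lemma comp_perm_eq_piCongrLeft (σ : Equiv.Perm (Fin n)) :
    (fun ξ : Fin n → ℝ => ξ ∘ σ) = MeasurableEquiv.piCongrLeft (fun _ : Fin n => ℝ) σ.symm := by
  funext ξ j
  have h := Equiv.piCongrLeft_apply_apply (fun _ : Fin n => ℝ) σ.symm ξ (σ j)
  rw [Equiv.symm_apply_apply] at h
  exact h.symm

lemma measurePreserving_comp_perm (σ : Equiv.Perm (Fin n)) :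
    MeasurePreserving (fun ξ : Fin n → ℝ => ξ ∘ σ) volume volume := by
  have h := volume_measurePreserving_piCongrLeft (fun _ : Fin n => ℝ) σ.symm
  convert! h using 1
  exact comp_perm_eq_piCongrLeft σ

lemma measurableEmbedding_comp_perm (σ : Equiv.Perm (Fin n)) :
    MeasurableEmbedding (fun ξ : Fin n → ℝ => ξ ∘ σ) := by
  have h := (MeasurableEquiv.piCongrLeft (fun _ : Fin n => ℝ) σ.symm).measurableEmbedding
  convert! h using 1
  exact comp_perm_eq_piCongrLeft σ

/-- The permuted alcoves cover the points of the open cube with distinct coordinates. As F vanishes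
at all other points, the decomposition holds pointwise, with no null sets to discard. -/
lemma setIntegral_cube_eq_factorial {F : (Fin n → ℝ) → ℂ}
    (hsymm : ∀ (σ : Equiv.Perm (Fin n)) ξ, F (ξ ∘ σ) = F ξ)
    (hzero : ∀ ξ, ¬Function.Injective ξ → F ξ = 0) (hint : IntegrableOn F (alcove n) volume) :
    ∫ ξ in Set.univ.pi fun _ : Fin n => Set.Ioo 0 Real.pi, F ξ =
      n.factorial * ∫ ξ in alcove n, F ξ := by
  classical
  let cube : Set (Fin n → ℝ) := Set.univ.pi fun _ : Fin n => Set.Ioo 0 Real.pi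
  have hcube : MeasurableSet cube := MeasurableSet.univ_pi fun _ => measurableSet_Ioo
  have hmem : ∀ (σ : Equiv.Perm (Fin n)) (ξ : Fin n → ℝ), ξ ∘ σ ∈ cube ↔ ξ ∈ cube := by
    intro σ ξ
    simp only [cube, Set.mem_univ_pi, Function.comp_apply]
    exact σ.forall_congr_left.trans (by simp)
  have hdecomp : ∀ ξ, cube.indicator F ξ =
      ∑ σ : Equiv.Perm (Fin n), (alcove n).indicator F (ξ ∘ σ) := by
    intro ξ
    rw [← sum_perm_ite_strictAnti (F := cube.indicator F)]
    · refine Finset.sum_congr rfl fun σ _ => ?_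
      have hiff : ξ ∘ σ ∈ alcove n ↔ StrictAnti (ξ ∘ σ) ∧ ξ ∘ σ ∈ cube := by
        simp [alcove, cube, and_comm]
      by_cases h1 : StrictAnti (ξ ∘ σ) <;> by_cases h2 : ξ ∘ σ ∈ cube <;>
        simp [Set.indicator, hiff, h1, h2]
    · intro σ η
      by_cases h : η ∈ cube
      · rw [Set.indicator_of_mem h, Set.indicator_of_mem ((hmem σ η).2 h), hsymm]
      · rw [Set.indicator_of_notMem h, Set.indicator_of_notMem fun h' => h ((hmem σ η).1 h')]
    · intro η hη
      by_cases h : η ∈ cube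
      · rw [Set.indicator_of_mem h, hzero η hη]
      · rw [Set.indicator_of_notMem h]
  have hintA : Integrable ((alcove n).indicator F) :=
    hint.integrable_indicator (measurableSet_alcove n)
  rw [← integral_indicator hcube, ← integral_indicator (measurableSet_alcove n)]
  simp only [hdecomp]
  have hintσ : ∀ σ : Equiv.Perm (Fin n),
      Integrable fun ξ : Fin n → ℝ => (alcove n).indicator F (ξ ∘ σ) := fun σ =>
    (measurePreserving_comp_perm σ).integrable_comp_of_integrable hintA
  rw [integral_finsetSum _ fun σ _ => hintσ σ]
  have h : ∀ σ : Equiv.Perm (Fin n), ∫ ξ : Fin n → ℝ, (alcove n).indicator F (ξ ∘ σ) =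
      ∫ ξ, (alcove n).indicator F ξ := fun σ =>
    (measurePreserving_comp_perm σ).integral_comp (measurableEmbedding_comp_perm σ) _
  simp only [h]
  rw [Finset.sum_const, Finset.card_univ, Fintype.card_perm, Fintype.card_fin, nsmul_eq_mul]

/-! ### The cubature rule -/

lemma denomO_zero (q0 : ℝ) (ξ : Fin n → ℝ) : denomO 0 q0 ξ = ∏ j, quadDen q0 (ξ j) := by
  simp [denomO, quadDen]

/-- Separates the integrand into a polynomial in the cosines and a product of one-variable
densities, the form required by `quadrature_cube`. -/
lemma ratFun_mul_rho (f : (Fin n → ℝ) → ℂ) (ξ : Fin n → ℝ) :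
    ratFun 0 q0 f ξ * (rho ξ : ℂ) = f ξ * (cosVandermondeSq ξ : ℂ) *
      ((∏ j, 4 * Real.sin (ξ j) ^ 2 / quadDen q0 (ξ j) : ℝ) : ℂ) := by
  rw [ratFun, denomO_zero, rho_eq, Finset.prod_div_distrib]
  push_cast
  ring

lemma integrableOn_ratFun_mul_rho {d : Fin n → ℕ} (hq0 : q0 ∈ Set.Ioo (-1 : ℝ) 1)
    {f : (Fin n → ℝ) → ℂ} (hf : IsCosPoly d f) :
    IntegrableOn (fun ξ : Fin n → ℝ => ratFun 0 q0 f ξ * (rho ξ : ℂ)) (alcove n) volume := by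
  refine IntegrableOn.mono_set (t := Set.univ.pi fun _ : Fin n => Set.Icc 0 Real.pi) ?_
    fun ξ hξ j _ => Set.Ioo_subset_Icc_self (hξ.1 j)
  simp only [ratFun_mul_rho]
  refine Continuous.continuousOn ?_ |>.integrableOn_compact (isCompact_univ_pi fun _ => isCompact_Icc)
  refine (hf.continuous.mul isCosPoly_cosVandermondeSq.continuous).mul
    (Complex.continuous_ofReal.comp (continuous_finsetProd _ fun j _ => ?_))
  exact Continuous.div (by fun_prop) ((continuous_quadDen q0).comp (continuous_apply j))
    fun ξ => (quadDen_pos hq0 _).ne'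

lemma cubature {m : ℕ} (hn : 0 < n) (hq0 : q0 ∈ Set.Ioo (-1 : ℝ) 1)
    (hq1 : q1 ∈ Set.Ioo (-1 : ℝ) 1) {f : (Fin n → ℝ) → ℂ} (hf : f ∈ polySpace (2 * m) n) :
    1 / (2 * (Real.pi : ℂ)) ^ n * ∫ ξ in alcove n, ratFun 0 q0 f ξ * (rho ξ : ℂ) =
      ∑ lam ∈ weights m n, ratFun 0 q0 f (node m 0 q0 q1 lam) *
        (rho (node m 0 q0 q1 lam) : ℂ) * (christoffel m 0 q0 q1 lam : ℂ) := by
  classical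
  have hpoly := isCosPoly_of_mem_polySpace hf
  have hfac : (n.factorial : ℂ) ≠ 0 := Nat.cast_ne_zero.2 (Nat.factorial_ne_zero n)
  have hpi : (2 * (Real.pi : ℂ)) ^ n ≠ 0 :=
    pow_ne_zero _ (mul_ne_zero two_ne_zero (Complex.ofReal_ne_zero.2 Real.pi_ne_zero))
  let S : (Fin n → ℕ) → ℂ := fun l =>
    f (rootVec (m + n) q0 q1 l) * (cosVandermondeSq (rootVec (m + n) q0 q1 l) : ℂ) *
      ((∏ j, 4 * Real.sin (rootVec (m + n) q0 q1 l j) ^ 2 /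
        kernelDiag (m + n) q0 (rootVec (m + n) q0 q1 l j) : ℝ) : ℂ)
  -- The degree is 2m from f plus 2(n - 1) from the Vandermonde square. As n ≥ 1, adding 2 gives
  -- exactly 2(m + n), so the one-variable rule is used at its full degree.
  have hcube := quadrature_cube (D := 2 * m + 2 * (n - 1)) (N := m + n) hq0 hq1 (by omega)
    (hpoly.mul isCosPoly_cosVandermondeSq)
  have hintegral := setIntegral_cube_eq_factorial
    (F := fun ξ : Fin n → ℝ => ratFun 0 q0 f ξ * (rho ξ : ℂ)) (fun σ ξ => by
      simp only [ratFun_mul_rho, polySpace_comp_perm hf, cosVandermondeSq_comp_perm,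
        Function.comp_apply]
      rw [Equiv.prod_comp σ fun j => 4 * Real.sin (ξ j) ^ 2 / quadDen q0 (ξ j)])
    (fun ξ hξ => by simp [ratFun_mul_rho, cosVandermondeSq_of_not_injective hξ])
    (integrableOn_ratFun_mul_rho hq0 hpoly)
  have hsum := sum_piFinset_eq_factorial (Finset.range (m + n)) (F := S) (fun σ l => by
      have h : rootVec (m + n) q0 q1 (l ∘ σ) = rootVec (m + n) q0 q1 l ∘ σ := rfl
      simp only [S, h, polySpace_comp_perm hf, cosVandermondeSq_comp_perm, Function.comp_apply]
      rw [Equiv.prod_comp σ fun j => 4 * Real.sin (rootVec (m + n) q0 q1 l j) ^ 2 /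
        kernelDiag (m + n) q0 (rootVec (m + n) q0 q1 l j)])
    (fun l hl => by
      have h : ¬Function.Injective (rootVec (m + n) q0 q1 l) := fun h' =>
        hl fun i j hij => h' (by simp only [rootVec, hij])
      simp [S, cosVandermondeSq_of_not_injective h])
  rw [nsmul_eq_mul, ← sum_weights_shifted] at hsum
  simp only [ratFun_mul_rho] at hintegral
  rw [hintegral] at hcube
  have hmain : ∫ ξ in alcove n, f ξ * (cosVandermondeSq ξ : ℂ) *
      ((∏ j, 4 * Real.sin (ξ j) ^ 2 / quadDen q0 (ξ j) : ℝ) : ℂ) =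
      (2 * (Real.pi : ℂ)) ^ n * ∑ μ ∈ weights m n, S (shifted μ) := by
    refine mul_left_cancel₀ hfac ?_
    rw [mul_left_comm, ← hsum]
    exact hcube
  simp only [ratFun_mul_rho]
  rw [hmain, one_div, inv_mul_cancel_left₀ hpi]
  refine Finset.sum_congr rfl fun lam hlam => ?_
  rw [christoffel_eq hq0 hq1 hlam, node_eq hq0 hq1 hlam, mul_assoc, ← Complex.ofReal_mul]
  simp only [S]
  congr 2
  -- The numerator of the Christoffel weight cancels the denominator of R, leaving the weights
  -- 1/`kernelDiag` of the product rule.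
  rw [Finset.prod_div_distrib, Finset.prod_div_distrib, div_mul_div_cancel₀
    (Finset.prod_ne_zero_iff.2 fun j _ => (quadDen_pos hq0 _).ne')]

end

end HallLittlewoodB

theorem mainTheorem9 (n m : ℕ) (hn : 0 < n) (hm : 0 < m) (q0 q1 : ℝ)
    (hq0 : q0 ∈ Set.Ioo (-1 : ℝ) 1) (hq1 : q1 ∈ Set.Ioo (-1 : ℝ) 1) :
    -- the nodes are well defined and lie in the fundamental domain
    (∀ lam ∈ HallLittlewoodB.weights m n,
      (∃! ξ : Fin n → ℝ, HallLittlewoodB.IsNode m 0 q0 q1 lam ξ) ∧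
      HallLittlewoodB.IsNode m 0 q0 q1 lam (HallLittlewoodB.node m 0 q0 q1 lam) ∧
      HallLittlewoodB.node m 0 q0 q1 lam ∈ HallLittlewoodB.alcove n) ∧
    -- the cubature rule
    (∀ f ∈ HallLittlewoodB.polySpace (2 * m) n,
      (∀ ξ : Fin n → ℝ, HallLittlewoodB.ratFun 0 q0 f ξ =
        f ξ / ((∏ j, (1 - 2 * q0 * Real.cos (ξ j) + q0 ^ 2) : ℝ) : ℂ)) ∧
      MeasureTheory.IntegrableOn
        (fun ξ : Fin n → ℝ =>
          HallLittlewoodB.ratFun 0 q0 f ξ * (HallLittlewoodB.rho ξ : ℂ))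
        (HallLittlewoodB.alcove n) MeasureTheory.volume ∧
      1 / (2 * (Real.pi : ℂ)) ^ n *
          ∫ ξ in HallLittlewoodB.alcove n,
            HallLittlewoodB.ratFun 0 q0 f ξ * (HallLittlewoodB.rho ξ : ℂ) =
        ∑ lam ∈ HallLittlewoodB.weights m n,
          HallLittlewoodB.ratFun 0 q0 f (HallLittlewoodB.node m 0 q0 q1 lam) *
            (HallLittlewoodB.rho (HallLittlewoodB.node m 0 q0 q1 lam) : ℂ) *
            (HallLittlewoodB.christoffel m 0 q0 q1 lam : ℂ)) ∧
    -- the coordinates of the nodes and the factorization of the Christoffel weights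
    (∀ lam ∈ HallLittlewoodB.weights m n,
      (∀ j : Fin n, HallLittlewoodB.node m 0 q0 q1 lam j =
        HallLittlewoodB.node1 (m + n) q0 q1 (lam j + (n - 1 - (j : ℕ)))) ∧
      HallLittlewoodB.christoffel m 0 q0 q1 lam =
        ∏ j : Fin n, HallLittlewoodB.christoffel1 (m + n) q0 q1 (lam j + (n - 1 - (j : ℕ)))) ∧
    -- the one-variable nodes and Christoffel weights
    (∀ l : ℕ, l < m + n →
      (∀ x : ℝ,
        2 * ((m : ℝ) + (n : ℝ)) * x + HallLittlewoodB.v q0 x + HallLittlewoodB.v q1 x =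
            2 * Real.pi * ((l : ℝ) + 1) ↔
          x = HallLittlewoodB.node1 (m + n) q0 q1 l) ∧
      HallLittlewoodB.christoffel1 (m + n) q0 q1 l =
        (2 * ((m : ℝ) + (n : ℝ)) +
          HallLittlewoodB.u q0 (HallLittlewoodB.node1 (m + n) q0 q1 l) +
          HallLittlewoodB.u q1 (HallLittlewoodB.node1 (m + n) q0 q1 l))⁻¹) := by

  have hval : ∀ lam : Fin n → ℕ, ∀ j : Fin n,
      lam j + (n - 1 - (j : ℕ)) = HallLittlewoodB.shifted lam j := fun _ _ => rfl
  refine ⟨fun lam hlam => ?_, fun f hf => ⟨fun ξ => ?_, ?_, ?_⟩, fun lam hlam => ⟨fun j => ?_, ?_⟩,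
    fun l hl => ⟨fun x => ?_, ?_⟩⟩
  · have hnode := HallLittlewoodB.node_eq hq0 hq1 hlam
    refine ⟨⟨_, (HallLittlewoodB.isNode_iff hq0 hq1 hlam _).2 rfl, fun ξ hξ =>
      (HallLittlewoodB.isNode_iff hq0 hq1 hlam ξ).1 hξ⟩,
      (HallLittlewoodB.isNode_iff hq0 hq1 hlam _).2 hnode, ?_⟩
    rw [hnode]
    exact HallLittlewoodB.rootVec_mem_alcove hq0 hq1 (HallLittlewoodB.shifted_lt hlam)
      (HallLittlewoodB.strictAnti_shifted hlam)
  · rw [HallLittlewoodB.ratFun, HallLittlewoodB.denomO_zero]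
    rfl
  · exact HallLittlewoodB.integrableOn_ratFun_mul_rho hq0
      (HallLittlewoodB.isCosPoly_of_mem_polySpace hf)
  · exact HallLittlewoodB.cubature hn hq0 hq1 hf
  · rw [HallLittlewoodB.node_eq hq0 hq1 hlam, hval,
      HallLittlewoodB.node1_eq hq0 hq1 (HallLittlewoodB.shifted_lt hlam j)]
    rfl
  · rw [HallLittlewoodB.christoffel_eq_prod hq0 hq1 hlam]
    refine Finset.prod_congr rfl fun j _ => ?_
    rw [hval, HallLittlewoodB.christoffel1_eq hq0 hq1 (HallLittlewoodB.shifted_lt hlam j)]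
  · rw [HallLittlewoodB.node1_eq hq0 hq1 hl, ← HallLittlewoodB.nodeFun_eq_iff hq0 hq1 hl,
      HallLittlewoodB.nodeFun, Nat.cast_add]
  · rw [HallLittlewoodB.christoffel1_eq hq0 hq1 hl, HallLittlewoodB.node1_eq hq0 hq1 hl,
      Nat.cast_add]
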